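/- **Model.** There are an odd number $M$ of websites and two groups of individuals $A$ and $B$ of equal size, with preferences for like-minded news $\gamma_A\neq\gamma_B$ in $[0,1]$. Let $p,q\in(\frac12,1)$ and $\mu\in(\frac12,1]$ with $\mu q>p$ ($q$ is the accuracy of the websites' signals). Fix the state of the world $\omega\in\{0,1\}$ and the websites' signals $y_1,\dots,y_M\in\{0,1\}$; let $y_K$ be the majority signal and $K=\{m: y_m=y_K\}$. In every period $t=1,2,\dots$ one individual enters, from group $A$ or $B$ with probability $\frac12$ each, and gets signals $x_t$ and $z_t$ with $\Pr(x_t=\omega)=p$ and $\Pr(z_t=y_K)=\mu$; group memberships and signals are independent, also across periods. An individual of group $\ell$ with signals $x,z$ has ranking-free value for website $m$ $$v^*_m=\frac{1}{\#\{m':y_{m'}=y_m\}}\cdot\begin{cases}1 & x=y_m=z\\ \gamma_\ell & x=y_m\neq z\\ 1-\gamma_\ell & x\neq y_m=z\\ 0&\text{otherwise}\end{cases}$$ (if all websites carry the same signal, $v^*_m=1$ for all $m$). When facing the ranking $r^\ell_t$ of group $\ell$, she clicks on $m$ with probability $\rho^\ell_{t,m}=r^\ell_{t,m}v^*_m/\sum_{m'}r^\ell_{t,m'}v^*_{m'}$.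 Both groups start from the same initial ranking $r_1$, a probability vector with positive entries. If the individual entering in period $t$ belongs to group $g$, then for $\ell=A,B$ $$r^\ell_{t+1,m}=\frac{\kappa_t}{1-\lambda_t^\ell+\kappa_t}\,r^\ell_{t,m}+\frac{1-\lambda_t^\ell}{1-\lambda_t^\ell+\kappa_t}\,\rho^g_{t,m},\qquad \lambda_t^\ell=\begin{cases}0&g=\ell\\ \lambda&g\neq\ell,\end{cases}$$ where $\lambda\in[0,1]$ is the personalization parameter and the persistence parameters $\kappa_t$ are positive integers with $\kappa_t\to\infty$ and $\kappa_t=O(t)$. Let $\widehat\rho^{\,\ell}_{N,K}=\mathbb E\big[\sum_{m\in K}\rho^\ell_{N,m}\big]$ be the expected probability that an individual of group $\ell$ searching in period $N$ clicks on a website in $K$. **Proposition.** For every $\lambda\in[0,1]$ the degree of belief polarization $\big|\widehat\rho^{\,A}_{N,K}-\widehat\rho^{\,B}_{N,K}\big|$ converges as $N\to\infty$, and its limit $\mathcal{BP}(\mathcal E_\lambda)$ is (weakly) increasing in $\lambda$ on $[0,1]$. -/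

import Mathlib

open MeasureTheory ProbabilityTheory Filter Topology Asymptotics

namespace SearchModel

/-- The two groups of individuals. -/
inductive Group : Type
  | A : Group
  | B : Group
  deriving DecidableEq

instance : MeasurableSpace Group := ⊤

/-- A personalized search environment (everything except the personalization parameter `lam`,
which is kept as a separate argument). -/
structure Environment where
  /-- accuracy of the individual signals on the state of the world -/
  p : ℝ
  /-- accuracy of the website signals -/
  q : ℝ
  /-- accuracy of the individual signals on the website-majority signal -/
  μ : ℝ
  half_lt_p : 1 / 2 < p
  p_lt_one : p < 1
  half_lt_q : 1 / 2 < q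
  q_lt_one : q < 1
  half_lt_μ : 1 / 2 < μ
  μ_le_one : μ ≤ 1
  p_lt_μ_mul_q : p < μ * q
  /-- number of websites -/
  M : ℕ
  odd_M : Odd M
  /-- preference for like-minded news in each group -/
  γ : Group → ℝ
  γ_nonneg : ∀ g, 0 ≤ γ g
  γ_le_one : ∀ g, γ g ≤ 1
  γ_ne : γ Group.A ≠ γ Group.B
  /-- proportion of the population that belongs to group `A`; it is the probability that the
  individual who enters in a given period comes from group `A` -/
  shareA : ℝ
  shareA_pos : 0 < shareA
  shareA_lt_one : shareA < 1
  /-- persistence of the ranking algorithm in each period -/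
  κ : ℕ → ℕ
  κ_pos : ∀ t, 0 < κ t
  /-- initial ranking, common to both groups: an interior point of the simplex -/
  r₁ : Fin M → ℝ
  r₁_pos : ∀ m, 0 < r₁ m
  r₁_sum : ∑ m, r₁ m = 1

/-- The website-majority signal of the profile `y` of website signals. -/
def majoritySignal {M : ℕ} (y : Fin M → Bool) : Bool :=
  decide ((Finset.univ.filter fun m => y m = false).card
    < (Finset.univ.filter fun m => y m = true).card)

/-- The set of websites that carry the website-majority signal. -/
def majoritySites {M : ℕ} (y : Fin M → Bool) : Finset (Fin M) :=
  Finset.univ.filter fun m => y m = majoritySignal y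

/-- Ranking-free value of website `m` for an individual with preference `γ` for like-minded news
and signals `x` (on the state of the world) and `z` (on the website-majority signal). If all
websites carry the same signal, every website is given the same value `1`. -/
noncomputable def rankingFreeValue {M : ℕ} (γ : ℝ) (y : Fin M → Bool) (x z : Bool)
    (m : Fin M) : ℝ :=
  if ∀ m₁ m₂, y m₁ = y m₂ then 1
  else
    (if x = y m ∧ z = y m then 1
      else if x = y m then γ
      else if z = y m then 1 - γ
      else 0) / ((Finset.univ.filter fun m' => y m' = y m).card : ℝ)

/-- Website choice function: probability that an individual with preference `γ` and signals `x`,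
`z`, who faces the ranking `r`, clicks on website `m`. -/
noncomputable def clickProb {M : ℕ} (γ : ℝ) (y : Fin M → Bool) (x z : Bool) (r : Fin M → ℝ)
    (m : Fin M) : ℝ :=
  r m * rankingFreeValue γ y x z m / ∑ m', r m' * rankingFreeValue γ y x z m'

/-- What is drawn in a period: the group of the individual who enters, whether the signal on the
state of the world is correct, and whether the signal on the website majority is correct. -/
abbrev Draw : Type := Group × Bool × Bool

/-- The signal with truth value `truth`, correct or not. -/
def signal (truth : Bool) (correct : Bool) : Bool :=
  if correct then truth else !truth

namespace Environment

/-- Law of one draw: group and correctness of the two signals are independent. -/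
noncomputable def drawLaw (E : Environment) : Measure Draw :=
  (bernoulliMeasure Group.A Group.B ⟨E.shareA, E.shareA_pos.le, E.shareA_lt_one.le⟩).prod
    ((bernoulliMeasure true false ⟨E.p, by linarith [E.half_lt_p], E.p_lt_one.le⟩).prod
      (bernoulliMeasure true false ⟨E.μ, by linarith [E.half_lt_μ], E.μ_le_one⟩))

instance (E : Environment) : IsProbabilityMeasure E.drawLaw := by
  unfold drawLaw
  infer_instance

/-- Law of the sequence of draws: independent and identically distributed over periods. -/
noncomputable def pathLaw (E : Environment) : Measure (ℕ → Draw) :=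
  Measure.infinitePi fun _ => E.drawLaw

/-- Click probability on website `m`, under ranking `r`, of an individual from group `g` whose
signals are correct or not according to `c` (first component: signal on the state `ω`; second
component: signal on the website-majority signal). -/
noncomputable def choice (E : Environment) (ω : Bool) (y : Fin E.M → Bool) (g : Group)
    (c : Bool × Bool) (r : Fin E.M → ℝ) (m : Fin E.M) : ℝ :=
  clickProb (E.γ g) y (signal ω c.1) (signal (majoritySignal y) c.2) r m

/-- The discount applied by the ranking of group `l` to the choice of an individual of
group `g`. -/
def discount (lam : ℝ) (l g : Group) : ℝ := if g = l then 0 else lam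

/-- The two rankings along a path of draws. Index `t` stands for the `(t+1)`-st period. The
individual of index `t`, from group `(d t).1`, faces the ranking of the own group, and her choice
updates the rankings of both groups. -/
noncomputable def ranking (E : Environment) (ω : Bool) (y : Fin E.M → Bool) (lam : ℝ)
    (d : ℕ → Draw) : ℕ → Group → Fin E.M → ℝ
  | 0 => fun _ => E.r₁
  | t + 1 => fun l m =>
      let g := (d t).1
      let k : ℝ := E.κ t
      let lt := discount lam l g
      k / (1 - lt + k) * E.ranking ω y lam d t l m
        + (1 - lt) / (1 - lt + k) *
          E.choice ω y g (d t).2 (E.ranking ω y lam d t g) m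

/-- Expected probability that an individual of group `l` who searches at index `t` clicks on a
website in `J`. -/
noncomputable def expectedClick (E : Environment) (ω : Bool) (y : Fin E.M → Bool) (lam : ℝ)
    (l : Group) (t : ℕ) (J : Finset (Fin E.M)) : ℝ :=
  ∫ d, ∑ m ∈ J, E.choice ω y l (d t).2 (E.ranking ω y lam d t l) m ∂E.pathLaw

/-- Degree of belief polarization at index `t`. -/
noncomputable def beliefPolarization (E : Environment) (ω : Bool) (y : Fin E.M → Bool)
    (lam : ℝ) (t : ℕ) : ℝ :=
  |E.expectedClick ω y lam Group.A t (majoritySites y)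
    - E.expectedClick ω y lam Group.B t (majoritySites y)|

end Environment

end SearchModel

/-!
If all websites carry the same signal, everybody clicks on a majority website and there is no
polarization. Otherwise the rankings enter only through the mass `σ l` that the ranking of group
`l` puts on the majority websites, and these two masses form a Markov chain with steps of order
`1 / κ t`. Put `s = 1 - λ`. The mean-field drift of `σ l` is proportional to
`∑ g, coupling s l g * (resp g (σ g) - σ l)`, where `resp g` is the expected click share of group
`g`: a mixture of functions `share k l` that multiply odds by a constant, among them the constant
`1` with positive weight.

*Comparison.* Multiplying the odds of all coordinates by `R > 1` is a concave operation that
commutes with `share`, so it turns a state with nonpositive drift into one with negative drift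
(`ClickModel.drift_oddsMul_neg`). Hence a state with nonpositive drift that lies below a state with
nonnegative drift equals it, provided that the upper state has the corner value `1` only where the
lower one does (`ClickModel.eq_of_drift_nonpos_of_drift_nonneg`).

*Convergence.* The steps need not be square summable, so convergence is proved in `L²`, by
recursions for expectations. The drift is cooperative, and an asymptotic bound of the chain at which
the drift points strictly inside can be improved (`ClickModel.exists_better_bound`). The best lower
and upper bounds thus have nonpositive and nonnegative drift, and the comparison identifies them.
The corner value `1` may be an unstable equilibrium; it is ruled out whenever some state below it
has nonpositive drift, with a weighted sum of the `1 / (1 - σ l)` as Lyapunov function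
(`ClickModel.exists_bound_lt_one`).

*Monotonicity.* Since `coupling s` is symmetric and the responses are increasing, the system has the
energy function of a Hopfield network, and the limit state minimizes it
(`ClickModel.IsAttractor.energy_le`). The parameter `s` enters the energy only through the term
`s / (2 * (1 + s)) * D ^ 2`, where `D` is the difference of the responses and `|D|` the limit of
the polarization. Comparing the minimizers for two values of `s` shows that `|D|` decreases in `s`.
-/

namespace SearchModel

/-! ### Click shares and multiplication of odds -/

/-- Probability of a click inside a block of websites that holds the fraction `a` of the ranking,
when each website of the block has value `k` and each website outside has value `l`. For `l = 0`
the value is `1` for every `a`, including `a = 0`, which makes the function continuous on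
`[0, 1]`. -/
noncomputable def share (k l a : ℝ) : ℝ := if l = 0 then 1 else k * a / (k * a + l * (1 - a))

/-- The point of `[0, 1]` whose odds are `R` times the odds of `x`. -/
noncomputable def oddsMul (R x : ℝ) : ℝ := R * x / (1 - x + R * x)

section Share

variable {k l a b R : ℝ}

lemma mix_pos (hk : 0 ≤ k) (hl : 0 ≤ l) (hl0 : l ≠ 0) (hk0 : k ≠ 0) (ha : a ∈ Set.Icc (0 : ℝ) 1) :
    0 < k * a + l * (1 - a) := by
  have hk' : 0 < k := lt_of_le_of_ne hk hk0.symm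
  have hl' : 0 < l := lt_of_le_of_ne hl hl0.symm
  obtain ⟨h0, h1⟩ := ha
  rcases h0.eq_or_lt with h | h
  · rw [← h]; simpa using hl'
  · have := mul_pos hk' h
    have := mul_nonneg hl (sub_nonneg.2 h1)
    linarith

lemma share_mem_Icc (hk : 0 ≤ k) (hl : 0 ≤ l) (ha : a ∈ Set.Icc (0 : ℝ) 1) :
    share k l a ∈ Set.Icc (0 : ℝ) 1 := by
  unfold share
  split_ifs with h
  · simp
  · have h1 := mul_nonneg hk ha.1
    have h2 := mul_nonneg hl (sub_nonneg.2 ha.2)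
    exact ⟨by positivity, div_le_one_of_le₀ (by linarith) (by positivity)⟩

/-- Click shares are nondecreasing and Lipschitz on `[0, 1]`. -/
lemma share_lipschitz (hk : 0 ≤ k) (hl : 0 ≤ l) :
    ∃ C : ℝ, 0 ≤ C ∧ ∀ a ∈ Set.Icc (0 : ℝ) 1, ∀ b ∈ Set.Icc (0 : ℝ) 1, a ≤ b →
      0 ≤ share k l b - share k l a ∧ share k l b - share k l a ≤ C * (b - a) := by
  by_cases hl0 : l = 0
  · exact ⟨0, le_rfl, fun a _ b _ _ => by simp [share, hl0]⟩
  by_cases hk0 : k = 0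
  · exact ⟨0, le_rfl, fun a _ b _ _ => by simp [share, hk0]⟩
  have hk' : 0 < k := lt_of_le_of_ne hk (Ne.symm hk0)
  have hl' : 0 < l := lt_of_le_of_ne hl (Ne.symm hl0)
  set e := min k l with he
  have he0 : 0 < e := lt_min hk' hl'
  have hlow : ∀ a ∈ Set.Icc (0 : ℝ) 1, e ≤ k * a + l * (1 - a) := by
    intro a ha
    have h1 := mul_le_mul_of_nonneg_right (min_le_left k l) ha.1
    have h2 := mul_le_mul_of_nonneg_right (min_le_right k l) (sub_nonneg.2 ha.2)
    rw [← he] at h1 h2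
    linarith
  refine ⟨k * l / (e * e), by positivity, fun a ha b hb hab => ?_⟩
  have hDa := hlow a ha
  have hDb := hlow b hb
  have hDa0 : 0 < k * a + l * (1 - a) := he0.trans_le hDa
  have hDb0 : 0 < k * b + l * (1 - b) := he0.trans_le hDb
  have key : share k l b - share k l a
      = k * l * (b - a) / ((k * b + l * (1 - b)) * (k * a + l * (1 - a))) := by
    simp only [share, hl0, if_false]
    rw [div_sub_div _ _ hDb0.ne' hDa0.ne']
    ring
  rw [key]
  have hba : 0 ≤ b - a := sub_nonneg.2 hab
  refine ⟨by positivity, ?_⟩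
  rw [div_mul_eq_mul_div]
  gcongr

lemma oddsMul_den_pos (hR : 1 ≤ R) (ha : 0 ≤ a) : 1 ≤ 1 - a + R * a := by nlinarith

lemma oddsMul_mem_Icc (hR : 1 ≤ R) (ha : a ∈ Set.Icc (0 : ℝ) 1) :
    oddsMul R a ∈ Set.Icc (0 : ℝ) 1 := by
  have := oddsMul_den_pos hR ha.1
  have h1 : 0 ≤ R * a := mul_nonneg (by linarith) ha.1
  exact ⟨div_nonneg h1 (by linarith), div_le_one_of_le₀ (by linarith [ha.2]) (by linarith)⟩

lemma oddsMul_lt_one (hR : 1 ≤ R) (ha : 0 ≤ a) (ha1 : a < 1) : oddsMul R a < 1 := by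
  have := oddsMul_den_pos hR ha
  rw [oddsMul, div_lt_one (by linarith)]
  linarith

lemma oddsMul_one_right (hR : 1 ≤ R) : oddsMul R 1 = 1 := by
  have : R ≠ 0 := by linarith
  simp [oddsMul, this]

lemma oddsMul_one_left : oddsMul 1 a = a := by simp [oddsMul]

lemma oddsMul_mono (hR : 1 ≤ R) {R' : ℝ} (hRR : R ≤ R') (ha : a ∈ Set.Icc (0 : ℝ) 1) :
    oddsMul R a ≤ oddsMul R' a := by
  have h1 := oddsMul_den_pos hR ha.1
  have h2 := oddsMul_den_pos (hR.trans hRR) ha.1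
  rw [oddsMul, oddsMul, div_le_div_iff₀ (by linarith) (by linarith)]
  nlinarith [mul_nonneg (mul_nonneg ha.1 (sub_nonneg.2 ha.2)) (sub_nonneg.2 hRR)]

/-- `oddsMul R` is concave: it stays below its tangents, with an explicit gap. -/
lemma oddsMul_tangent (hR : 1 ≤ R) {m x : ℝ} (hm : 0 ≤ m) (hx : 0 ≤ x) :
    oddsMul R x + R * (R - 1) * (x - m) ^ 2 / ((1 - m + R * m) ^ 2 * (1 - x + R * x))
      = oddsMul R m + R / (1 - m + R * m) ^ 2 * (x - m) := by
  have h1 := oddsMul_den_pos hR hm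
  have h2 := oddsMul_den_pos hR hx
  have h1' : 1 - m + R * m ≠ 0 := by linarith
  have h2' : 1 - x + R * x ≠ 0 := by linarith
  rw [oddsMul, oddsMul]
  field_simp
  ring

/-- A click share turns the odds of its argument into a fixed multiple of these odds, so it
commutes with a further multiplication of odds. -/
lemma share_oddsMul (hk : 0 ≤ k) (hl : 0 ≤ l) (hR : 1 ≤ R) (ha : a ∈ Set.Icc (0 : ℝ) 1) :
    share k l (oddsMul R a) = oddsMul R (share k l a) := by
  by_cases hl0 : l = 0
  · simp only [share, hl0, if_true]; rw [oddsMul_one_right hR]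
  by_cases hk0 : k = 0
  · simp [share, hk0, hl0, oddsMul]
  have hD := mix_pos hk hl hl0 hk0 ha
  have hO := oddsMul_den_pos hR ha.1
  have hE := mix_pos (mul_nonneg hk (zero_le_one.trans hR)) hl hl0
    (mul_ne_zero hk0 (by linarith : R ≠ 0)) ha
  have hO' : 1 - a + R * a ≠ 0 := by linarith
  have hD' : k * a + l * (1 - a) ≠ 0 := hD.ne'
  have hE' : k * R * a + l * (1 - a) ≠ 0 := hE.ne'
  have h1 : 1 - R * a / (1 - a + R * a) = (1 - a) / (1 - a + R * a) := by
    rw [eq_div_iff hO', sub_mul, div_mul_cancel₀ _ hO']; ring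
  have h2 : 1 - k * a / (k * a + l * (1 - a)) = l * (1 - a) / (k * a + l * (1 - a)) := by
    rw [eq_div_iff hD', sub_mul, div_mul_cancel₀ _ hD']; ring
  simp only [share, hl0, if_false, oddsMul]
  rw [h1, h2, ← mul_div_assoc, ← mul_div_assoc, ← mul_div_assoc, ← add_div, ← add_div,
    div_div_div_cancel_right₀ hO', div_div_div_cancel_right₀ hD']
  congr 1 <;> ring

end Share

/-! ### The aggregate model -/

instance : Fintype Group := ⟨{Group.A, Group.B}, by intro x; cases x <;> decide⟩

lemma sum_group {α : Type*} [AddCommMonoid α] (F : Group → α) :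
    ∑ g, F g = F Group.A + F Group.B := by
  show ∑ g ∈ ({Group.A, Group.B} : Finset Group), F g = _
  rw [Finset.sum_insert (by decide), Finset.sum_singleton]

/-- The search model after aggregation over the block of majority websites: `prob` is the law of
the correctness of the two signals, and an individual of group `g` with signals `c` attaches the
value `wK g c` to every website in the block and `wL g c` to every website outside. With positive
probability the signals (`sure`) leave no value to the websites outside the block. -/
structure ClickModel where
  prob : Bool × Bool → ℝ
  prob_nonneg : ∀ c, 0 ≤ prob c
  prob_sum : ∑ c, prob c = 1
  wK : Group → Bool × Bool → ℝ
  wL : Group → Bool × Bool → ℝ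
  wK_nonneg : ∀ g c, 0 ≤ wK g c
  wL_nonneg : ∀ g c, 0 ≤ wL g c
  w_pos : ∀ g c, 0 < wK g c + wL g c
  sure : Bool × Bool
  sure_pos : 0 < prob sure
  wL_sure : ∀ g, wL g sure = 0

/-- Weight of the choice of an individual of group `g` in the ranking of group `l`, where `s` is
one minus the personalization parameter. -/
def coupling (s : ℝ) (l g : Group) : ℝ := if g = l then 1 else s

lemma coupling_nonneg {s : ℝ} (hs : 0 ≤ s) (l g : Group) : 0 ≤ coupling s l g := by
  unfold coupling; split_ifs <;> simp [hs]

lemma coupling_le_one {s : ℝ} (hs : s ≤ 1) (l g : Group) : coupling s l g ≤ 1 := by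
  unfold coupling; split_ifs <;> simp [hs]

lemma coupling_self (s : ℝ) (l : Group) : coupling s l l = 1 := by simp [coupling]

lemma coupling_sum (s : ℝ) (l : Group) : ∑ g, coupling s l g = 1 + s := by
  cases l <;> simp [sum_group, coupling, add_comm]

namespace ClickModel

variable (Q : ClickModel) {s : ℝ}

/-- Click share of the block for an individual of group `g` with signals `c`. -/
noncomputable def click (g : Group) (c : Bool × Bool) (a : ℝ) : ℝ :=
  share (Q.wK g c) (Q.wL g c) a

/-- Expected click share of the block for group `g`. -/
noncomputable def resp (g : Group) (a : ℝ) : ℝ := ∑ c, Q.prob c * Q.click g c a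

/-- Mean-field drift (up to a positive factor) of the ranking mass of the block: groups of equal
size pull the ranking of group `l` towards their own click shares. -/
noncomputable def drift (s : ℝ) (σ : Group → ℝ) (l : Group) : ℝ :=
  ∑ g, coupling s l g * (Q.resp g (σ g) - σ l)

lemma click_mem_Icc (g : Group) (c : Bool × Bool) {a : ℝ} (ha : a ∈ Set.Icc (0 : ℝ) 1) :
    Q.click g c a ∈ Set.Icc (0 : ℝ) 1 :=
  share_mem_Icc (Q.wK_nonneg g c) (Q.wL_nonneg g c) ha

lemma click_sure (g : Group) (a : ℝ) : Q.click g Q.sure a = 1 := by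
  simp [click, share, Q.wL_sure]

lemma sum_prob_mul (y : ℝ) : ∑ c, Q.prob c * y = y := by
  rw [← Finset.sum_mul, Q.prob_sum, one_mul]

lemma resp_mem_Icc (g : Group) {a : ℝ} (ha : a ∈ Set.Icc (0 : ℝ) 1) :
    Q.resp g a ∈ Set.Icc (0 : ℝ) 1 := by
  refine ⟨Finset.sum_nonneg fun c _ => mul_nonneg (Q.prob_nonneg c) (Q.click_mem_Icc g c ha).1, ?_⟩
  rw [← Q.sum_prob_mul 1]
  exact Finset.sum_le_sum fun c _ =>
    mul_le_mul_of_nonneg_left (Q.click_mem_Icc g c ha).2 (Q.prob_nonneg c)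

lemma resp_pos (g : Group) {a : ℝ} (ha : a ∈ Set.Icc (0 : ℝ) 1) : 0 < Q.resp g a := by
  have h := Finset.single_le_sum (f := fun c => Q.prob c * Q.click g c a)
    (fun c _ => mul_nonneg (Q.prob_nonneg c) (Q.click_mem_Icc g c ha).1) (Finset.mem_univ Q.sure)
  simp only [Q.click_sure, mul_one] at h
  exact Q.sure_pos.trans_le h

lemma exists_resp_lipschitz :
    ∃ C : ℝ, 0 ≤ C ∧ ∀ g, ∀ a ∈ Set.Icc (0 : ℝ) 1, ∀ b ∈ Set.Icc (0 : ℝ) 1, a ≤ b →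
      0 ≤ Q.resp g b - Q.resp g a ∧ Q.resp g b - Q.resp g a ≤ C * (b - a) := by
  choose C hC0 hC using fun (g : Group) (c : Bool × Bool) =>
    share_lipschitz (Q.wK_nonneg g c) (Q.wL_nonneg g c)
  refine ⟨∑ g, ∑ c, Q.prob c * C g c, Finset.sum_nonneg fun g _ => Finset.sum_nonneg fun c _ =>
    mul_nonneg (Q.prob_nonneg c) (hC0 g c), fun g a ha b hb hab => ?_⟩
  have heq : Q.resp g b - Q.resp g a = ∑ c, Q.prob c * (Q.click g c b - Q.click g c a) := by
    simp only [resp, mul_sub, Finset.sum_sub_distrib]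
  rw [heq]
  refine ⟨Finset.sum_nonneg fun c _ => mul_nonneg (Q.prob_nonneg c) (hC g c a ha b hb hab).1, ?_⟩
  have h1 : ∑ c, Q.prob c * (Q.click g c b - Q.click g c a)
      ≤ (∑ c, Q.prob c * C g c) * (b - a) := by
    rw [Finset.sum_mul]
    refine Finset.sum_le_sum fun c _ => ?_
    rw [mul_assoc]
    exact mul_le_mul_of_nonneg_left (hC g c a ha b hb hab).2 (Q.prob_nonneg c)
  refine h1.trans (mul_le_mul_of_nonneg_right ?_ (sub_nonneg.2 hab))
  exact Finset.single_le_sum (f := fun g => ∑ c, Q.prob c * C g c)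
    (fun g _ => Finset.sum_nonneg fun c _ => mul_nonneg (Q.prob_nonneg c) (hC0 g c))
    (Finset.mem_univ g)

lemma resp_mono (g : Group) {a b : ℝ} (ha : a ∈ Set.Icc (0 : ℝ) 1) (hb : b ∈ Set.Icc (0 : ℝ) 1)
    (hab : a ≤ b) : Q.resp g a ≤ Q.resp g b := by
  obtain ⟨C, -, hC⟩ := Q.exists_resp_lipschitz
  exact sub_nonneg.1 (hC g a ha b hb hab).1

lemma continuousOn_resp (g : Group) : ContinuousOn (Q.resp g) (Set.Icc 0 1) := by
  obtain ⟨C, hC0, hC⟩ := Q.exists_resp_lipschitz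
  refine (LipschitzOnWith.of_dist_le_mul (K := ⟨C, hC0⟩) fun x hx y hy => ?_).continuousOn
  show |_| ≤ C * |_|
  rcases le_total x y with h | h
  · have := hC g x hx y hy h
    rw [abs_sub_comm, abs_of_nonneg this.1, abs_sub_comm, abs_of_nonneg (sub_nonneg.2 h)]
    exact this.2
  · have := hC g y hy x hx h
    rw [abs_of_nonneg this.1, abs_of_nonneg (sub_nonneg.2 h)]
    exact this.2

lemma drift_eq (s : ℝ) (σ : Group → ℝ) (l : Group) :
    Q.drift s σ l = ∑ g, coupling s l g * Q.resp g (σ g) - (1 + s) * σ l := by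
  simp only [drift, mul_sub, Finset.sum_sub_distrib, ← Finset.sum_mul, coupling_sum]

/-- The drift is cooperative. -/
lemma drift_mono (hs : 0 ≤ s) {σ τ : Group → ℝ} (hσ : ∀ g, σ g ∈ Set.Icc (0 : ℝ) 1)
    (hτ : ∀ g, τ g ∈ Set.Icc (0 : ℝ) 1) (hle : ∀ g, σ g ≤ τ g) {l : Group} (hl : σ l = τ l) :
    Q.drift s σ l ≤ Q.drift s τ l := by
  rw [drift_eq, drift_eq, hl]
  gcongr with g
  · exact coupling_nonneg hs l g
  · exact Q.resp_mono g (hσ g) (hτ g) (hle g)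

lemma drift_nonpos_of_eq_one (hs : 0 ≤ s) {σ : Group → ℝ} (hσ : ∀ g, σ g ∈ Set.Icc (0 : ℝ) 1)
    {l : Group} (hl : σ l = 1) : Q.drift s σ l ≤ 0 := by
  refine Finset.sum_nonpos fun g _ => mul_nonpos_of_nonneg_of_nonpos (coupling_nonneg hs l g) ?_
  have := (Q.resp_mem_Icc g (hσ g)).2
  linarith

lemma drift_pos_of_eq_zero (hs : 0 ≤ s) {σ : Group → ℝ} (hσ : ∀ g, σ g ∈ Set.Icc (0 : ℝ) 1)
    {l : Group} (hl : σ l = 0) : 0 < Q.drift s σ l := by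
  simp only [drift, hl, sub_zero]
  refine Finset.sum_pos' (fun g _ => mul_nonneg (coupling_nonneg hs l g)
    (Q.resp_pos g (hσ g)).le) ⟨l, Finset.mem_univ l, ?_⟩
  rw [coupling_self, one_mul]
  exact Q.resp_pos l (hσ l)

/-! ### Comparison of sub- and superequilibria -/

/-- If the drift is nonpositive at `σ`, multiplying the odds of all coordinates by the same factor
`R > 1` makes it negative. The responses are mixtures of click shares, which commute with
`oddsMul R`, and `oddsMul R` lies below its tangent at `σ l`, strictly so at the click share `1`
that has positive weight. -/
lemma drift_oddsMul_neg (hs : 0 ≤ s) {R : ℝ} (hR : 1 < R) {σ : Group → ℝ}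
    (hσ : ∀ g, σ g ∈ Set.Icc (0 : ℝ) 1) {l : Group} (hl : σ l < 1) (hd : Q.drift s σ l ≤ 0) :
    Q.drift s (fun g => oddsMul R (σ g)) l < 0 := by
  set m := σ l with hm
  have hm0 : 0 ≤ m := (hσ l).1
  have hD := oddsMul_den_pos hR.le hm0
  set G : ℝ := R / (1 - m + R * m) ^ 2 with hG
  have hG0 : 0 < G := by positivity
  have htan : ∀ x ∈ Set.Icc (0 : ℝ) 1, oddsMul R x ≤ oddsMul R m + G * (x - m) := by
    intro x hx
    rw [← oddsMul_tangent hR.le hm0 hx.1]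
    have h2 := oddsMul_den_pos hR.le hx.1
    have h3 : 0 ≤ R - 1 := by linarith
    have : 0 ≤ R * (R - 1) * (x - m) ^ 2 / ((1 - m + R * m) ^ 2 * (1 - x + R * x)) := by positivity
    linarith
  have htan1 : 1 < oddsMul R m + G * (1 - m) := by
    rw [← oddsMul_tangent hR.le hm0 zero_le_one, oddsMul_one_right hR.le]
    have h3 : 0 < R - 1 := by linarith
    have h4 : 0 < 1 - m := by linarith
    have : 0 < R * (R - 1) * (1 - m) ^ 2 / ((1 - m + R * m) ^ 2 * (1 - 1 + R * 1)) := by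
      have : 0 < 1 - 1 + R * 1 := by linarith
      positivity
    linarith
  have hresp : ∀ g, Q.resp g (oddsMul R (σ g)) < oddsMul R m + G * (Q.resp g (σ g) - m) := by
    intro g
    have heq : oddsMul R m + G * (Q.resp g (σ g) - m)
        = ∑ c, Q.prob c * (oddsMul R m + G * (Q.click g c (σ g) - m)) := by
      have : ∀ c, Q.prob c * (oddsMul R m + G * (Q.click g c (σ g) - m))
          = Q.prob c * (oddsMul R m - G * m) + G * (Q.prob c * Q.click g c (σ g)) := by
        intro c; ring
      simp only [this, Finset.sum_add_distrib, Q.sum_prob_mul, ← Finset.mul_sum, resp]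
      ring
    rw [heq]
    have hcl : ∀ c, Q.click g c (oddsMul R (σ g)) = oddsMul R (Q.click g c (σ g)) := fun c =>
      share_oddsMul (Q.wK_nonneg g c) (Q.wL_nonneg g c) hR.le (hσ g)
    simp only [resp, hcl]
    refine Finset.sum_lt_sum (fun c _ => mul_le_mul_of_nonneg_left
      (htan _ (Q.click_mem_Icc g c (hσ g))) (Q.prob_nonneg c)) ⟨Q.sure, Finset.mem_univ _, ?_⟩
    rw [Q.click_sure, oddsMul_one_right hR.le]
    exact mul_lt_mul_of_pos_left htan1 Q.sure_pos
  have h1 : Q.drift s (fun g => oddsMul R (σ g)) l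
      < ∑ g, coupling s l g * (G * (Q.resp g (σ g) - m)) := by
    refine Finset.sum_lt_sum (fun g _ => mul_le_mul_of_nonneg_left ?_ (coupling_nonneg hs l g))
      ⟨l, Finset.mem_univ l, ?_⟩
    · have := hresp g
      beta_reduce; rw [← hm]; linarith
    · rw [coupling_self, one_mul, one_mul]
      have := hresp l
      beta_reduce; rw [← hm]; linarith
  have h2 : ∑ g, coupling s l g * (G * (Q.resp g (σ g) - m)) = G * Q.drift s σ l := by
    simp only [drift, Finset.mul_sum, ← hm]
    exact Finset.sum_congr rfl fun g _ => by ring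
  rw [h2] at h1
  exact h1.trans_le (mul_nonpos_of_nonneg_of_nonpos hG0.le hd)

/-- A superequilibrium that lies below a subequilibrium coincides with it, provided that the
latter reaches the corner value `1` only where the former does: the largest ratio of odds between
the two cannot exceed `1`. -/
theorem eq_of_drift_nonpos_of_drift_nonneg (hs : 0 ≤ s) {lo up : Group → ℝ}
    (hlo : ∀ g, lo g ∈ Set.Ioc (0 : ℝ) 1) (hup : ∀ g, up g ∈ Set.Ioc (0 : ℝ) 1)
    (hle : ∀ g, lo g ≤ up g) (hlt : ∀ g, lo g < 1 → up g < 1)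
    (hsup : ∀ g, Q.drift s lo g ≤ 0) (hsub : ∀ g, 0 ≤ Q.drift s up g) : lo = up := by
  classical
  have hloI : ∀ g, lo g ∈ Set.Icc (0 : ℝ) 1 := fun g => ⟨(hlo g).1.le, (hlo g).2⟩
  have hupI : ∀ g, up g ∈ Set.Icc (0 : ℝ) 1 := fun g => ⟨(hup g).1.le, (hup g).2⟩
  have hr : ∀ g, ∃ r : ℝ, 1 ≤ r ∧ oddsMul r (lo g) = up g ∧ (1 < r → lo g < 1) := by
    intro g
    rcases (hlo g).2.lt_or_eq with h | h
    · have hu := hlt g h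
      have h0 := (hlo g).1
      have hg := hle g
      refine ⟨up g * (1 - lo g) / (lo g * (1 - up g)), ?_, ?_, fun _ => h⟩
      · rw [le_div_iff₀ (mul_pos h0 (by linarith))]; nlinarith
      · have h1 : lo g ≠ 0 := h0.ne'
        have h2 : 1 - up g ≠ 0 := by linarith
        have h3 : 1 - lo g ≠ 0 := by linarith
        have h4 : up g * (1 - lo g) / (lo g * (1 - up g)) * lo g
            = up g * (1 - lo g) / (1 - up g) := by field_simp
        have h5 : 1 - lo g + up g * (1 - lo g) / (1 - up g) = (1 - lo g) / (1 - up g) := by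
          field_simp; ring
        rw [oddsMul, h4, h5]
        field_simp
    · refine ⟨1, le_rfl, ?_, fun h' => absurd h' (lt_irrefl _)⟩
      have := hle g
      rw [oddsMul_one_left]
      linarith [(hup g).2]
  choose r hr1 hru hr2 using hr
  obtain ⟨g₀, hg₀⟩ : ∃ g₀, ∀ g, r g ≤ r g₀ :=
    haveI : Nonempty Group := ⟨Group.A⟩
    Finite.exists_max r
  rcases (hr1 g₀).eq_or_lt with h | h
  · funext g
    have h1 : r g = 1 := le_antisymm (h ▸ hg₀ g) (hr1 g)
    rw [← hru g, h1, oddsMul_one_left]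
  · exfalso
    have hneg := Q.drift_oddsMul_neg hs h hloI (hr2 g₀ h) (hsup g₀)
    have hmono := Q.drift_mono hs (τ := fun g => oddsMul (r g₀) (lo g)) hupI
      (fun g => oddsMul_mem_Icc h.le (hloI g))
      (fun g => hru g ▸ oddsMul_mono (hr1 g) (hg₀ g) (hloI g)) (l := g₀) (hru g₀).symm
    linarith [hsub g₀]

end ClickModel

/-! ### A stochastic-approximation recursion -/

/-- Square of the positive part. -/
noncomputable def psq (x : ℝ) : ℝ := max x 0 ^ 2

lemma psq_nonneg (x : ℝ) : 0 ≤ psq x := sq_nonneg _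

lemma psq_mono {x y : ℝ} (h : x ≤ y) : psq x ≤ psq y :=
  pow_le_pow_left₀ (le_max_right _ _) (max_le_max_right 0 h) 2

lemma psq_add_le (x h : ℝ) : psq (x + h) ≤ psq x + 2 * max x 0 * h + h ^ 2 := by
  have h1 : max (x + h) 0 ≤ |max x 0 + h| := by
    refine max_le (le_trans ?_ (le_abs_self _)) (abs_nonneg _)
    linarith [le_max_left x 0]
  have h2 : max (x + h) 0 ^ 2 ≤ |max x 0 + h| ^ 2 := pow_le_pow_left₀ (le_max_right _ _) h1 2
  rw [sq_abs] at h2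
  unfold psq
  nlinarith

lemma tendsto_zero_of_recursion {e ε δ : ℕ → ℝ} {c : ℝ} (hc : 0 < c) (he : ∀ t, 0 ≤ e t)
    (hε : ∀ t, 0 ≤ ε t) (hε0 : Tendsto ε atTop (𝓝 0)) (hsum : ¬ Summable ε)
    (hδ : Tendsto δ atTop (𝓝 0))
    (hrec : ∀ᶠ t in atTop, e (t + 1) ≤ (1 - c * ε t) * e t + ε t * δ t) :
    Tendsto e atTop (𝓝 0) := by
  rw [Metric.tendsto_atTop]
  intro r hr
  set η := r / 2 with hη
  have hη0 : 0 < η := by positivity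
  have hev : ∀ᶠ t in atTop, e (t + 1) ≤ (1 - c * ε t) * e t + ε t * δ t ∧ δ t < c * η ∧
      ε t < 1 / c :=
    hrec.and ((hδ.eventually_lt_const (by positivity)).and
      (hε0.eventually_lt_const (by positivity)))
  obtain ⟨T, hT⟩ := eventually_atTop.1 hev
  have hbound : ∀ n, e (T + n) - η
      ≤ max (e T - η) 0 * Real.exp (-c * ∑ i ∈ Finset.range n, ε (T + i)) := by
    intro n
    induction n with
    | zero => simp
    | succ n ih =>
      obtain ⟨h1, h2, h3⟩ := hT (T + n) (by omega)
      have hε' := hε (T + n)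
      have h4 : c * ε (T + n) ≤ 1 := by
        rw [lt_div_iff₀ hc] at h3
        linarith
      have h5 : ε (T + n) * δ (T + n) ≤ ε (T + n) * (c * η) :=
        mul_le_mul_of_nonneg_left h2.le hε'
      have h6 : e (T + (n + 1)) - η ≤ (1 - c * ε (T + n)) * (e (T + n) - η) := by
        rw [← add_assoc]
        nlinarith
      refine h6.trans ?_
      have h7 : 1 - c * ε (T + n) ≤ Real.exp (-c * ε (T + n)) := by
        have := Real.add_one_le_exp (-c * ε (T + n))
        linarith
      have h8 : (1 - c * ε (T + n)) * (e (T + n) - η) ≤ (1 - c * ε (T + n)) *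
          (max (e T - η) 0 * Real.exp (-c * ∑ i ∈ Finset.range n, ε (T + i))) :=
        mul_le_mul_of_nonneg_left ih (by linarith)
      refine h8.trans ?_
      rw [Finset.sum_range_succ, mul_add, Real.exp_add]
      have h9 : 0 ≤ max (e T - η) 0 * Real.exp (-c * ∑ i ∈ Finset.range n, ε (T + i)) := by
        positivity
      nlinarith
  have hdiv : Tendsto (fun n => ∑ i ∈ Finset.range n, ε (T + i)) atTop atTop := by
    rw [← not_summable_iff_tendsto_nat_atTop_of_nonneg (fun i => hε _)]
    intro h
    refine hsum ((summable_nat_add_iff T).1 ?_)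
    simpa [add_comm] using h
  have hlim : Tendsto (fun n => max (e T - η) 0 *
      Real.exp (-c * ∑ i ∈ Finset.range n, ε (T + i))) atTop (𝓝 (max (e T - η) 0 * 0)) := by
    refine Tendsto.const_mul _ (Real.tendsto_exp_atBot.comp ?_)
    exact hdiv.const_mul_atTop_of_neg (by linarith)
  rw [mul_zero] at hlim
  obtain ⟨N, hN⟩ := eventually_atTop.1 (hlim.eventually_lt_const hη0)
  refine ⟨T + N, fun n hn => ?_⟩
  obtain ⟨m, rfl⟩ := Nat.exists_eq_add_of_le hn
  have h1 := hbound (N + m)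
  have h2 := hN (N + m) (by omega)
  rw [← add_assoc] at h1
  rw [Real.dist_eq, sub_zero, abs_of_nonneg (he _)]
  linarith

namespace ClickModel

variable (Q : ClickModel)

/-! ### The Markov chain of ranking masses -/

/-- Both groups give the block and its complement positive ranking mass. -/
def IsInterior (σ : Group → ℝ) : Prop := ∀ g, σ g ∈ Set.Ioo (0 : ℝ) 1

/-- Ranking masses of the block after a draw, for persistence `k`. -/
noncomputable def update (s k : ℝ) (d : Draw) (σ : Group → ℝ) (l : Group) : ℝ :=
  k / (coupling s l d.1 + k) * σ l
    + coupling s l d.1 / (coupling s l d.1 + k) * Q.click d.1 d.2 (σ d.1)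

/-- Probability of a draw, for groups of equal size. -/
noncomputable def weight (d : Draw) : ℝ := 1 / 2 * Q.prob d.2

/-- Transition operator of the chain. -/
noncomputable def trans (s k : ℝ) (φ : (Group → ℝ) → ℝ) (σ : Group → ℝ) : ℝ :=
  ∑ d, Q.weight d * φ (Q.update s k d σ)

/-- Expectation of `φ` at the state of the chain at time `t`, started from `σ₀`. It is defined by
backward recursion, which dispenses with measurability and integrability. -/
noncomputable def ev (s : ℝ) (κ : ℕ → ℝ) (σ₀ : Group → ℝ) : ℕ → ((Group → ℝ) → ℝ) → ℝ
  | 0, φ => φ σ₀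
  | t + 1, φ => ev s κ σ₀ t (Q.trans s (κ t) φ)

variable {Q} {s k : ℝ} {κ : ℕ → ℝ} {σ₀ : Group → ℝ}

lemma weight_nonneg (d : Draw) : 0 ≤ Q.weight d :=
  mul_nonneg (by norm_num) (Q.prob_nonneg d.2)

lemma sum_weight_mul (F : Draw → ℝ) :
    ∑ d, Q.weight d * F d = 1 / 2 * ∑ g, ∑ c, Q.prob c * F (g, c) := by
  rw [Fintype.sum_prod_type, Finset.mul_sum]
  refine Finset.sum_congr rfl fun g _ => ?_
  rw [Finset.mul_sum]
  exact Finset.sum_congr rfl fun c _ => by rw [weight, mul_assoc]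

lemma sum_weight : ∑ d, Q.weight d = 1 := by
  have := Q.sum_weight_mul fun _ => 1
  simp only [mul_one, Q.prob_sum, sum_group] at this
  rw [this]; norm_num

lemma update_eq (hs : 0 ≤ s) (hk : 0 < k) (d : Draw) (σ : Group → ℝ) (l : Group) :
    Q.update s k d σ l = σ l + coupling s l d.1 / (coupling s l d.1 + k)
      * (Q.click d.1 d.2 (σ d.1) - σ l) := by
  have h := coupling_nonneg hs l d.1
  have h' : coupling s l d.1 + k ≠ 0 := by linarith
  rw [update]
  field_simp
  ring

lemma IsInterior.mem_Icc {σ : Group → ℝ} (h : IsInterior σ) (g : Group) :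
    σ g ∈ Set.Icc (0 : ℝ) 1 := ⟨(h g).1.le, (h g).2.le⟩

lemma IsInterior.update (hs : 0 ≤ s) (hk : 0 < k) {σ : Group → ℝ} (h : IsInterior σ) (d : Draw) :
    IsInterior (Q.update s k d σ) := by
  intro l
  have hc := coupling_nonneg hs l d.1
  have hcl := Q.click_mem_Icc d.1 d.2 (h.mem_Icc d.1)
  have hD : 0 < coupling s l d.1 + k := by linarith
  have h1 : Q.update s k d σ l
      = (k * σ l + coupling s l d.1 * Q.click d.1 d.2 (σ d.1)) / (coupling s l d.1 + k) := by
    rw [ClickModel.update]; ring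
  have h2 := mul_pos hk (h l).1
  have h3 := mul_lt_mul_of_pos_left (h l).2 hk
  have h4 := mul_nonneg hc hcl.1
  have h5 := mul_le_mul_of_nonneg_left hcl.2 hc
  rw [h1]
  refine ⟨div_pos (by linarith) hD, (div_lt_one hD).2 (by linarith)⟩

lemma ev_add (t : ℕ) (φ ψ : (Group → ℝ) → ℝ) :
    Q.ev s κ σ₀ t (fun σ => φ σ + ψ σ) = Q.ev s κ σ₀ t φ + Q.ev s κ σ₀ t ψ := by
  induction t generalizing φ ψ with
  | zero => rfl
  | succ t ih =>
    simp only [ev]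
    rw [← ih]
    congr 1
    funext σ
    simp only [trans, mul_add, Finset.sum_add_distrib]

lemma ev_const_mul (t : ℕ) (r : ℝ) (φ : (Group → ℝ) → ℝ) :
    Q.ev s κ σ₀ t (fun σ => r * φ σ) = r * Q.ev s κ σ₀ t φ := by
  induction t generalizing φ with
  | zero => rfl
  | succ t ih =>
    simp only [ev]
    rw [← ih]
    congr 1
    funext σ
    simp only [trans, Finset.mul_sum]
    exact Finset.sum_congr rfl fun d _ => by ring

lemma ev_const (t : ℕ) (r : ℝ) : Q.ev s κ σ₀ t (fun _ => r) = r := by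
  induction t with
  | zero => rfl
  | succ t ih =>
    simp only [ev]
    have : Q.trans s (κ t) (fun _ => r) = fun _ => r := by
      funext σ
      simp only [trans, ← Finset.sum_mul, sum_weight, one_mul]
    rw [this, ih]

lemma ev_sum (t : ℕ) (φ : Group → (Group → ℝ) → ℝ) :
    Q.ev s κ σ₀ t (fun σ => ∑ g, φ g σ) = ∑ g, Q.ev s κ σ₀ t (φ g) := by
  simp only [sum_group, ev_add]

lemma ev_mono (hs : 0 ≤ s) (hκ : ∀ t, 0 < κ t) (hσ₀ : IsInterior σ₀) (t : ℕ)
    {φ ψ : (Group → ℝ) → ℝ} (h : ∀ σ, IsInterior σ → φ σ ≤ ψ σ) :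
    Q.ev s κ σ₀ t φ ≤ Q.ev s κ σ₀ t ψ := by
  induction t generalizing φ ψ with
  | zero => exact h _ hσ₀
  | succ t ih =>
    refine ih fun σ hσ => Finset.sum_le_sum fun d _ => ?_
    exact mul_le_mul_of_nonneg_left (h _ (hσ.update hs (hκ t) d)) (weight_nonneg d)

lemma ev_nonneg (hs : 0 ≤ s) (hκ : ∀ t, 0 < κ t) (hσ₀ : IsInterior σ₀) (t : ℕ)
    {φ : (Group → ℝ) → ℝ} (h : ∀ σ, IsInterior σ → 0 ≤ φ σ) : 0 ≤ Q.ev s κ σ₀ t φ := by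
  have := ev_mono (Q := Q) hs hκ hσ₀ t h
  rwa [ev_const] at this

lemma trans_psq_le {ξ : (Group → ℝ) → ℝ} {σ : Group → ℝ} {Δ : Draw → ℝ}
    (h : ∀ d, ξ (Q.update s k d σ) ≤ ξ σ + Δ d) :
    Q.trans s k (fun σ => psq (ξ σ)) σ ≤ psq (ξ σ)
      + 2 * max (ξ σ) 0 * ∑ d, Q.weight d * Δ d + ∑ d, Q.weight d * Δ d ^ 2 := by
  have h1 : Q.trans s k (fun σ => psq (ξ σ)) σ
      ≤ ∑ d, Q.weight d * (psq (ξ σ) + 2 * max (ξ σ) 0 * Δ d + Δ d ^ 2) :=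
    Finset.sum_le_sum fun d _ => mul_le_mul_of_nonneg_left
      ((psq_mono (h d)).trans (psq_add_le _ _)) (weight_nonneg d)
  refine h1.trans_eq ?_
  simp only [mul_add, Finset.sum_add_distrib, ← Finset.sum_mul, sum_weight, one_mul]
  congr 2
  rw [Finset.mul_sum]
  exact Finset.sum_congr rfl fun d _ => by ring

/-! ### Improving asymptotic bounds -/

/-- One step moves a coordinate by at most `1 / k`, and on average by the drift divided by `2 k`,
up to an error of order `1 / k ^ 2`. The sign `ς` serves to treat both directions at once. -/
lemma mean_update_sub_le (hs : 0 ≤ s) (hs1 : s ≤ 1) (hk : 0 < k) {σ : Group → ℝ}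
    (hσ : IsInterior σ) (l : Group) {ς : ℝ} (hς : |ς| = 1) :
    ∑ d, Q.weight d * (ς * (Q.update s k d σ l - σ l))
        ≤ 1 / 2 * (1 / k) * (ς * Q.drift s σ l) + (1 / k) ^ 2 ∧
      ∑ d, Q.weight d * (ς * (Q.update s k d σ l - σ l)) ^ 2 ≤ (1 / k) ^ 2 := by
  have hstep : ∀ d, ς * (Q.update s k d σ l - σ l)
      = coupling s l d.1 / (coupling s l d.1 + k) * (ς * (Q.click d.1 d.2 (σ d.1) - σ l)) := by
    intro d
    rw [update_eq hs hk]; ring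
  constructor
  · have h1 : ∑ d, Q.weight d * (ς * (Q.update s k d σ l - σ l))
        = 1 / 2 * ∑ g, coupling s l g / (coupling s l g + k)
          * (ς * (Q.resp g (σ g) - σ l)) := by
      rw [sum_weight_mul]
      congr 1
      refine Finset.sum_congr rfl fun g _ => ?_
      have h2 : ∀ c, Q.prob c * (ς * (Q.update s k (g, c) σ l - σ l))
          = coupling s l g / (coupling s l g + k) * ς * (Q.prob c * Q.click g c (σ g))
            - Q.prob c * (coupling s l g / (coupling s l g + k) * ς * σ l) := by
        intro c; rw [hstep]; ring
      simp only [h2, Finset.sum_sub_distrib, Q.sum_prob_mul, ← Finset.mul_sum, resp]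
      ring
    have h3 : ∀ g, coupling s l g / (coupling s l g + k) * (ς * (Q.resp g (σ g) - σ l))
        ≤ coupling s l g * (1 / k) * (ς * (Q.resp g (σ g) - σ l)) + (1 / k) ^ 2 := by
      intro g
      have hc := coupling_nonneg hs l g
      have hc1 := coupling_le_one hs1 l g
      have hr := Q.resp_mem_Icc g (hσ.mem_Icc g)
      have hl := hσ.mem_Icc l
      have habs : |ς * (Q.resp g (σ g) - σ l)| ≤ 1 := by
        rw [abs_mul, hς, one_mul, abs_le]
        constructor <;> linarith [hr.1, hr.2, hl.1, hl.2]
      have hD : 0 < coupling s l g + k := by linarith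
      have hdiff : coupling s l g / (coupling s l g + k) = coupling s l g * (1 / k)
          - coupling s l g ^ 2 / (k * (coupling s l g + k)) := by
        field_simp
        ring
      have hq : coupling s l g ^ 2 / (k * (coupling s l g + k)) ≤ (1 / k) ^ 2 := by
        rw [div_pow, one_pow, div_le_div_iff₀ (by positivity) (by positivity)]
        have : coupling s l g ^ 2 ≤ 1 := pow_le_one₀ hc hc1
        nlinarith [mul_pos hk hk, mul_nonneg hk.le hc]
      have hq0 : 0 ≤ coupling s l g ^ 2 / (k * (coupling s l g + k)) := by positivity
      rw [hdiff, sub_mul]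
      have := neg_abs_le (coupling s l g ^ 2 / (k * (coupling s l g + k))
        * (ς * (Q.resp g (σ g) - σ l)))
      rw [abs_mul, abs_of_nonneg hq0] at this
      have h4 := mul_le_mul_of_nonneg_left habs hq0
      linarith
    rw [h1]
    have h4 : ∑ g, coupling s l g / (coupling s l g + k) * (ς * (Q.resp g (σ g) - σ l))
        ≤ (1 / k) * (ς * Q.drift s σ l) + 2 * (1 / k) ^ 2 := by
      refine (Finset.sum_le_sum fun g _ => h3 g).trans_eq ?_
      simp only [drift, sum_group]
      ring
    linarith
  · have h5 : ∀ d : Draw, Q.weight d * (ς * (Q.update s k d σ l - σ l)) ^ 2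
        ≤ Q.weight d * (1 / k) ^ 2 := by
      intro d
      refine mul_le_mul_of_nonneg_left ?_ (weight_nonneg d)
      rw [hstep, ← sq_abs, abs_mul]
      have hc := coupling_nonneg hs l d.1
      have hc1 := coupling_le_one hs1 l d.1
      have hcl := Q.click_mem_Icc d.1 d.2 (hσ.mem_Icc d.1)
      have hl := hσ.mem_Icc l
      have habs : |ς * (Q.click d.1 d.2 (σ d.1) - σ l)| ≤ 1 := by
        rw [abs_mul, hς, one_mul, abs_le]
        constructor <;> linarith [hcl.1, hcl.2, hl.1, hl.2]
      have hq : |coupling s l d.1 / (coupling s l d.1 + k)| ≤ 1 / k := by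
        rw [abs_of_nonneg (by positivity)]
        exact div_le_div₀ zero_le_one hc1 hk (by linarith)
      refine pow_le_pow_left₀ (by positivity) ?_ 2
      calc _ ≤ 1 / k * 1 := mul_le_mul hq habs (abs_nonneg _) (by positivity)
        _ = 1 / k := mul_one _
    refine (Finset.sum_le_sum fun d _ => h5 d).trans_eq ?_
    rw [← Finset.sum_mul, sum_weight, one_mul]

/-- Let `u` be an asymptotic bound of the chain, from above if `ς = 1` and from below if `ς = -1`.
If the drift of coordinate `l` at `u` points strictly inside the bound, then the bound on this
coordinate can be improved. -/
theorem exists_better_bound (hs : 0 ≤ s) (hs1 : s ≤ 1) (hκ : ∀ t, 0 < κ t)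
    (hκ0 : Tendsto (fun t => 1 / κ t) atTop (𝓝 0)) (hκs : ¬ Summable fun t => 1 / κ t)
    (hσ₀ : IsInterior σ₀) {ς : ℝ} (hς : ς = 1 ∨ ς = -1) {u : Group → ℝ}
    (hu : ∀ g, u g ∈ Set.Icc (0 : ℝ) 1)
    (hlev : ∀ g, Tendsto (fun t => Q.ev s κ σ₀ t fun σ => psq (ς * (σ g - u g))) atTop (𝓝 0))
    {l : Group} (hd : ς * Q.drift s u l < 0) :
    ∃ δ : ℝ, 0 < δ ∧
      Tendsto (fun t => Q.ev s κ σ₀ t fun σ => psq (ς * (σ l - u l) + δ)) atTop (𝓝 0) := by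
  have hςabs : |ς| = 1 := by rcases hς with h | h <;> simp [h]
  obtain ⟨C, hC0, hC⟩ := Q.exists_resp_lipschitz
  set η : ℝ := -(ς * Q.drift s u l) with hη
  have hη0 : 0 < η := by linarith
  set δ : ℝ := min (η / 8) 1 with hδ
  have hδ0 : 0 < δ := lt_min (by positivity) one_pos
  have hδη : δ ≤ η / 8 := min_le_left _ _
  have hδ1 : δ ≤ 1 := min_le_right _ _
  set B : ℝ := 2 * C ^ 2 / η with hB
  have hB0 : 0 ≤ B := by positivity
  refine ⟨δ, hδ0, ?_⟩
  -- Increments of the responses in the direction `ς`; the linear bound is split by the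
  -- inequality of arithmetic and geometric means.
  have hincr : ∀ σ, IsInterior σ → ∀ g,
      ς * (Q.resp g (σ g) - Q.resp g (u g)) ≤ η / 8 + B * psq (ς * (σ g - u g)) := by
    intro σ hσ g
    have h1 : ς * (Q.resp g (σ g) - Q.resp g (u g)) ≤ C * max (ς * (σ g - u g)) 0 := by
      rcases le_total (σ g) (u g) with h | h
      · have := hC g _ (hσ.mem_Icc g) _ (hu g) h
        rcases hς with h' | h' <;> subst h'
        · have : 0 ≤ C * max (1 * (σ g - u g)) 0 := by positivity
          linarith
        · have : C * (-1 * (σ g - u g)) ≤ C * max (-1 * (σ g - u g)) 0 :=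
            mul_le_mul_of_nonneg_left (le_max_left _ _) hC0
          linarith
      · have := hC g _ (hu g) _ (hσ.mem_Icc g) h
        rcases hς with h' | h' <;> subst h'
        · have : C * (1 * (σ g - u g)) ≤ C * max (1 * (σ g - u g)) 0 :=
            mul_le_mul_of_nonneg_left (le_max_left _ _) hC0
          linarith
        · have : 0 ≤ C * max (-1 * (σ g - u g)) 0 := by positivity
          linarith
    refine h1.trans ?_
    have h2 : η / 8 + B * psq (ς * (σ g - u g)) - C * max (ς * (σ g - u g)) 0
        = (η - 4 * C * max (ς * (σ g - u g)) 0) ^ 2 / (8 * η) := by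
      rw [hB, psq]
      field_simp
      ring
    have h3 : 0 ≤ (η - 4 * C * max (ς * (σ g - u g)) 0) ^ 2 / (8 * η) := by positivity
    linarith
  have hdrift : ∀ σ, IsInterior σ → -δ < ς * (σ l - u l) →
      ς * Q.drift s σ l ≤ -(η / 2) + B * ∑ g, psq (ς * (σ g - u g)) := by
    intro σ hσ hgt
    have h1 : ς * Q.drift s σ l = -η + ∑ g, coupling s l g *
        (ς * (Q.resp g (σ g) - Q.resp g (u g))) - (1 + s) * (ς * (σ l - u l)) := by
      rw [hη, drift_eq, drift_eq]
      simp only [sum_group]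
      ring
    have h2 : ∑ g, coupling s l g * (ς * (Q.resp g (σ g) - Q.resp g (u g)))
        ≤ ∑ g, (η / 8 + B * psq (ς * (σ g - u g))) := by
      refine Finset.sum_le_sum fun g _ => ?_
      have h3 := hincr σ hσ g
      have h4 : 0 ≤ η / 8 + B * psq (ς * (σ g - u g)) := by
        have := psq_nonneg (ς * (σ g - u g)); positivity
      calc _ ≤ coupling s l g * (η / 8 + B * psq (ς * (σ g - u g))) :=
            mul_le_mul_of_nonneg_left h3 (coupling_nonneg hs l g)
        _ ≤ 1 * (η / 8 + B * psq (ς * (σ g - u g))) :=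
            mul_le_mul_of_nonneg_right (coupling_le_one hs1 l g) h4
        _ = _ := one_mul _
    rw [Finset.sum_add_distrib, ← Finset.mul_sum] at h2
    have h5 : ∑ _g : Group, η / 8 = η / 4 := by rw [sum_group]; ring
    have h6 : -((1 + s) * (ς * (σ l - u l))) ≤ 2 * δ := by nlinarith
    rw [h1]
    linarith
  refine tendsto_zero_of_recursion (c := η / 4) (ε := fun t => 1 / κ t)
    (δ := fun t => 2 * B * ∑ g, Q.ev s κ σ₀ t (fun σ => psq (ς * (σ g - u g))) + 5 * (1 / κ t))
    (by positivity) (fun t => ev_nonneg hs hκ hσ₀ t fun σ _ => psq_nonneg _)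
    (fun t => by have := hκ t; positivity) hκ0 hκs ?_ (Eventually.of_forall fun t => ?_)
  · have h1 : Tendsto (fun t => ∑ g, Q.ev s κ σ₀ t (fun σ => psq (ς * (σ g - u g)))) atTop
        (𝓝 (∑ _g : Group, (0 : ℝ))) := tendsto_finsetSum _ fun g _ => hlev g
    simpa using (h1.const_mul (2 * B)).add (hκ0.const_mul 5)
  · set ε := 1 / κ t with hε
    have hε0 : 0 < ε := by have := hκ t; positivity
    have hpt : ∀ σ, IsInterior σ →
        Q.trans s (κ t) (fun σ => psq (ς * (σ l - u l) + δ)) σ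
          ≤ (1 - η / 4 * ε) * psq (ς * (σ l - u l) + δ)
            + (ε * (2 * B) * ∑ g, psq (ς * (σ g - u g)) + 5 * ε ^ 2) := by
      intro σ hσ
      set x := ς * (σ l - u l) + δ with hx
      have hx2 : max x 0 ≤ 2 := by
        refine max_le ?_ (by norm_num)
        have : |ς * (σ l - u l)| ≤ 1 := by
          rw [abs_mul, hςabs, one_mul, abs_le]
          constructor <;> linarith [(hσ l).1, (hσ l).2, (hu l).1, (hu l).2]
        linarith [le_abs_self (ς * (σ l - u l))]
      have hx0 : 0 ≤ max x 0 := le_max_right _ _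
      have h1 := trans_psq_le (Q := Q) (s := s) (k := κ t) (σ := σ)
        (ξ := fun σ => ς * (σ l - u l) + δ)
        (Δ := fun d => ς * (Q.update s (κ t) d σ l - σ l)) (fun d => by
          show _ ≤ _; apply le_of_eq; ring)
      obtain ⟨h2, h3⟩ := mean_update_sub_le (Q := Q) hs hs1 (hκ t) hσ l hςabs
      rw [← hε] at h2 h3
      rw [← hx] at h1
      have hS : 0 ≤ ∑ g, psq (ς * (σ g - u g)) := Finset.sum_nonneg fun g _ => psq_nonneg _
      have h4 : max x 0 * (ς * Q.drift s σ l)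
          ≤ -(η / 4) * psq x + 2 * B * ∑ g, psq (ς * (σ g - u g)) := by
        rcases le_or_gt x 0 with h | h
        · have h5 : max x 0 = 0 := max_eq_right h
          rw [psq, h5]
          have := mul_nonneg hB0 hS
          linarith
        · have h5 := hdrift σ hσ (by linarith)
          have h6 := mul_le_mul_of_nonneg_left h5 hx0
          have h7 : psq x ≤ 2 * max x 0 := by rw [psq]; nlinarith
          have h8 := mul_nonneg hB0 hS
          nlinarith
      have h9 : 2 * max x 0 * ∑ d, Q.weight d * (ς * (Q.update s (κ t) d σ l - σ l))
          ≤ 2 * max x 0 * (1 / 2 * ε * (ς * Q.drift s σ l) + ε ^ 2) :=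
        mul_le_mul_of_nonneg_left h2 (by positivity)
      have h10 := mul_le_mul_of_nonneg_left h4 hε0.le
      have h11 := mul_le_mul_of_nonneg_right hx2 (sq_nonneg ε)
      nlinarith
    have h1 := ev_mono (Q := Q) hs hκ hσ₀ t hpt
    rw [ev_add, ev_const_mul, ev_add, ev_const_mul, ev_const, ev_sum] at h1
    refine h1.trans_eq ?_
    ring

end ClickModel

/-! ### Repulsion from full concentration on the block -/

/-- Growth of `x = 1 / (1 - a)` in one step of the update with persistence `k` and weight `w`,
where `χ` is the click share outside the block. -/
lemma inv_step_le {k w x χ j J : ℝ} (hk : 0 < k) (hw : 0 ≤ w) (hw1 : w ≤ 1) (hx : 0 < x)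
    (hj : 0 ≤ j) (hjJ : j ≤ J) (hχ : j ≤ χ * x) :
    1 / ((k * (1 / x) + w * χ) / (w + k)) ≤ x + x * (w * (1 - j) * (1 / k) + J ^ 2 * (1 / k) ^ 2) := by
  have hwk : 0 < w + k := by linarith
  have hwj : 0 ≤ w * j := mul_nonneg hw hj
  have hwχ : w * j ≤ w * (χ * x) := mul_le_mul_of_nonneg_left hχ hw
  have h1 : 1 / ((k * (1 / x) + w * χ) / (w + k)) = x * ((w + k) / (k + w * (χ * x))) := by
    have hD : k + w * (χ * x) ≠ 0 := by linarith
    have hE : k * (1 / x) + w * χ = (k + w * (χ * x)) / x := by field_simp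
    rw [hE]
    field_simp
  have h2 : (w + k) / (k + w * (χ * x)) ≤ (w + k) / (k + w * j) := by
    gcongr
  have h3 : (w + k) / (k + w * j) ≤ 1 + (w * (1 - j) * (1 / k) + J ^ 2 * (1 / k) ^ 2) := by
    rw [div_le_iff₀ (by linarith)]
    have h4 : (1 + (w * (1 - j) * (1 / k) + J ^ 2 * (1 / k) ^ 2)) * (k + w * j)
        = (w + k) + (w ^ 2 * j + (J ^ 2 - w ^ 2 * j ^ 2) + J ^ 2 * (w * j) * (1 / k)) * (1 / k) := by
      field_simp
      ring
    have h5 : w ^ 2 * j ^ 2 ≤ J ^ 2 := by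
      have h6 : w * j ≤ J := by nlinarith
      have := pow_le_pow_left₀ hwj h6 2
      rwa [mul_pow] at this
    have h7 : 0 ≤ (w ^ 2 * j + (J ^ 2 - w ^ 2 * j ^ 2) + J ^ 2 * (w * j) * (1 / k)) * (1 / k) := by
      have : 0 ≤ J ^ 2 - w ^ 2 * j ^ 2 := by linarith
      positivity
    linarith
  rw [h1]
  calc _ ≤ x * (1 + (w * (1 - j) * (1 / k) + J ^ 2 * (1 / k) ^ 2)) :=
        mul_le_mul_of_nonneg_left (h2.trans h3) hx.le
    _ = _ := by ring

/-- Quadratic inequality behind the choice of the coefficients `(n l + τ) * W l ^ 3`. They nearly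
symmetrize the matrix `coupling s l g * n g`; the term `τ` keeps them positive if `n l = 0`. A
vanishing `W l` removes the coordinate `l`, since the quotients by `W l` are multiplied by `0`. -/
lemma sum_coupling_quadratic_le {s η τ : ℝ} (hs : 0 ≤ s) (hη : 0 < η) (hτ : 0 ≤ τ)
    {W n x : Group → ℝ} (hW : ∀ g, 0 ≤ W g) (hn : ∀ g, 0 ≤ n g) (hx : ∀ g, 0 ≤ x g)
    (hWn : ∀ l, (1 + s + η) * W l ≤ ∑ g, coupling s l g * (n g * W g))
    (hτW : ∀ l, W l = 0 ∨ τ * ∑ g, coupling s l g * W g ≤ η / 2 * W l) :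
    ∑ l, (n l + τ) * W l ^ 3 * ∑ g, coupling s l g *
        (x l - 2 * (W g / W l) * n g * x l + (W g / W l) ^ 2 * n g * x g)
      ≤ -(η / 2) * ∑ l, (n l + τ) * W l ^ 3 * x l := by
  have h1 : ∀ l, (n l + τ) * W l ^ 3 * ∑ g, coupling s l g *
        (x l - 2 * (W g / W l) * n g * x l + (W g / W l) ^ 2 * n g * x g)
      = (n l + τ) * ∑ g, coupling s l g *
        (W l ^ 3 * x l - 2 * W l ^ 2 * W g * n g * x l + W l * W g ^ 2 * n g * x g) := by
    intro l
    rw [mul_assoc, Finset.mul_sum]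
    congr 1
    refine Finset.sum_congr rfl fun g _ => ?_
    rcases eq_or_ne (W l) 0 with h | h
    · simp [h]
    · field_simp
  have h2 : ∀ l, W l ^ 2 * x l * ((n l + τ) * ((1 + s) * W l)
      - (n l + 2 * τ) * ∑ g, coupling s l g * (n g * W g)
      + n l * (τ * ∑ g, coupling s l g * W g) + η / 2 * ((n l + τ) * W l)) ≤ 0 := by
    intro l
    rcases eq_or_ne (W l) 0 with h | h
    · simp [h]
    · have h3 := (hτW l).resolve_left h
      have h4 := mul_le_mul_of_nonneg_left h3 (hn l)
      have h5 := mul_le_mul_of_nonneg_left (hWn l)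
        (by have := hn l; positivity : 0 ≤ n l + 2 * τ)
      refine mul_nonpos_of_nonneg_of_nonpos (by have := hx l; positivity) ?_
      have h6 : 0 ≤ τ * ((1 + s) * W l) := by have := hW l; positivity
      have h7 : 0 ≤ τ * (η * W l) := by have := hW l; positivity
      nlinarith
  have h3 := add_nonpos (h2 Group.A) (h2 Group.B)
  simp only [h1]
  simp only [sum_group, coupling] at h3 ⊢
  simp only [if_true, reduceCtorEq, if_false] at h3 ⊢
  linarith

namespace ClickModel

variable {Q : ClickModel} {s : ℝ} {κ : ℕ → ℝ} {σ₀ : Group → ℝ}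

lemma sum_prob_quadratic (m : Bool × Bool → ℝ) (a b d : ℝ) :
    ∑ c, Q.prob c * (a + m c * b + m c ^ 2 * d)
      = a + (∑ c, Q.prob c * m c) * b + (∑ c, Q.prob c * m c ^ 2) * d := by
  have : ∀ c, Q.prob c * (a + m c * b + m c ^ 2 * d)
      = Q.prob c * a + Q.prob c * m c * b + Q.prob c * m c ^ 2 * d := fun c => by ring
  simp only [this, Finset.sum_add_distrib, Q.sum_prob_mul, ← Finset.sum_mul]

/-- A nonnegative function `Y` of the chain whose mean increments are at most
`(-(η / 2) * Y + K) / (2 κ)`, up to second-order terms proportional to `Y`, is asymptotically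
bounded by every `y₀ ≥ 4 * K / η`. -/
theorem tendsto_psq_sub_of_mean_le (hs : 0 ≤ s) (hκ : ∀ t, 0 < κ t)
    (hκ0 : Tendsto (fun t => 1 / κ t) atTop (𝓝 0)) (hκs : ¬ Summable fun t => 1 / κ t)
    (hσ₀ : IsInterior σ₀) {Y : (Group → ℝ) → ℝ} {Δ : ℝ → (Group → ℝ) → Draw → ℝ}
    {η K J C y₀ : ℝ} (hη : 0 < η) (hy₀1 : 1 ≤ y₀) (hy₀K : K ≤ η / 4 * y₀)
    (hY0 : ∀ σ, IsInterior σ → 0 ≤ Y σ)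
    (hstep : ∀ t σ, IsInterior σ → ∀ d, Y (Q.update s (κ t) d σ) ≤ Y σ + Δ (1 / κ t) σ d)
    (hmean : ∀ ε, 0 ≤ ε → ∀ σ, IsInterior σ → ∑ d, Q.weight d * Δ ε σ d
      ≤ 1 / 2 * ε * (-(η / 2) * Y σ + K) + J ^ 2 * ε ^ 2 * Y σ)
    (hsize : ∀ ε, 0 ≤ ε → ε ≤ 1 → ∀ σ, IsInterior σ → ∀ d, |Δ ε σ d| ≤ C * ε * Y σ) :
    Tendsto (fun t => Q.ev s κ σ₀ t fun σ => psq (Y σ - y₀)) atTop (𝓝 0) := by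
  set D : ℝ := 4 * J ^ 2 + 2 * C ^ 2 with hD
  have hD0 : 0 ≤ D := by positivity
  refine tendsto_zero_of_recursion (c := η / 8) (ε := fun t => 1 / κ t)
    (δ := fun t => D * y₀ ^ 2 * (1 / κ t))
    (by positivity) (fun t => ev_nonneg hs hκ hσ₀ t fun σ _ => psq_nonneg _)
    (fun t => by have := hκ t; positivity) hκ0 hκs
    (by simpa using hκ0.const_mul (D * y₀ ^ 2)) ?_
  have hsmall : ∀ᶠ t in atTop, 1 / κ t < 1 ∧ 1 / κ t < η / (8 * (D + 1)) :=
    (hκ0.eventually_lt_const one_pos).and (hκ0.eventually_lt_const (by positivity))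
  filter_upwards [hsmall] with t ht
  set ε := 1 / κ t with hε
  have hε0 : 0 < ε := by have := hκ t; positivity
  have hDε : D * ε ≤ η / 8 := by
    have h1 := ht.2
    rw [lt_div_iff₀ (by positivity)] at h1
    nlinarith
  have hpt : ∀ σ, IsInterior σ → Q.trans s (κ t) (fun σ => psq (Y σ - y₀)) σ
      ≤ (1 - η / 8 * ε) * psq (Y σ - y₀) + D * y₀ ^ 2 * ε ^ 2 := by
    intro σ hσ
    have h1 := trans_psq_le (Q := Q) (s := s) (k := κ t) (σ := σ) (ξ := fun σ => Y σ - y₀)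
      (Δ := Δ ε σ) (fun d => by have := hstep t σ hσ d
                                rw [← hε] at this
                                show Y _ - y₀ ≤ Y σ - y₀ + _
                                linarith)
    have h2 := hmean ε hε0.le σ hσ
    have h3 : ∑ d, Q.weight d * Δ ε σ d ^ 2 ≤ (C * ε * Y σ) ^ 2 := by
      have h4 : ∀ d : Draw, Q.weight d * Δ ε σ d ^ 2 ≤ Q.weight d * (C * ε * Y σ) ^ 2 := by
        intro d
        refine mul_le_mul_of_nonneg_left ?_ (weight_nonneg d)
        rw [← sq_abs]
        exact pow_le_pow_left₀ (abs_nonneg _) (hsize ε hε0.le ht.1.le σ hσ d) 2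
      refine (Finset.sum_le_sum fun d _ => h4 d).trans_eq ?_
      rw [← Finset.sum_mul, sum_weight, one_mul]
    have hYσ := hY0 σ hσ
    set p := max (Y σ - y₀) 0 with hp
    have hp0 : 0 ≤ p := le_max_right _ _
    have hYp : Y σ ≤ p + y₀ := by linarith [le_max_left (Y σ - y₀) 0]
    have hpsq : psq (Y σ - y₀) = p ^ 2 := rfl
    have h5 : 2 * p * ∑ d, Q.weight d * Δ ε σ d
        ≤ -(η / 4 * ε) * p ^ 2 + 2 * J ^ 2 * ε ^ 2 * (p + y₀) ^ 2 := by
      have h6 := mul_le_mul_of_nonneg_left h2 (by positivity : 0 ≤ 2 * p)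
      refine h6.trans ?_
      have h7 : p * (-(η / 2) * Y σ + K) ≤ -(η / 4) * p ^ 2 := by
        rcases le_or_gt (Y σ - y₀) 0 with h | h
        · have : p = 0 := max_eq_right h
          simp [this]
        · have hpe : p = Y σ - y₀ := max_eq_left h.le
          have : -(η / 2) * Y σ + K ≤ -(η / 4) * p := by
            rw [hpe]; nlinarith
          calc _ ≤ p * (-(η / 4) * p) := mul_le_mul_of_nonneg_left this hp0
            _ = _ := by ring
      have h8 : p * Y σ ≤ (p + y₀) ^ 2 := by nlinarith
      have h9 := mul_le_mul_of_nonneg_left h7 hε0.le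
      have h10 := mul_le_mul_of_nonneg_left h8 (by positivity : 0 ≤ 2 * J ^ 2 * ε ^ 2)
      nlinarith
    have h6 : (C * ε * Y σ) ^ 2 ≤ C ^ 2 * ε ^ 2 * (p + y₀) ^ 2 := by
      rw [mul_pow, mul_pow]
      exact mul_le_mul_of_nonneg_left (pow_le_pow_left₀ hYσ hYp 2) (by positivity)
    have h7 : (p + y₀) ^ 2 ≤ 2 * (p ^ 2 + y₀ ^ 2) := by nlinarith [sq_nonneg (p - y₀)]
    have h8 := mul_le_mul_of_nonneg_left h7
      (by positivity : 0 ≤ (2 * J ^ 2 + C ^ 2) * ε ^ 2)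
    have h9 : D * ε * (ε * p ^ 2) ≤ η / 8 * (ε * p ^ 2) :=
      mul_le_mul_of_nonneg_right hDε (by positivity)
    simp only [hpsq] at h1
    rw [hpsq]
    nlinarith
  have h1 := ev_mono (Q := Q) hs hκ hσ₀ t hpt
  rw [ev_add, ev_const_mul, ev_const] at h1
  refine h1.trans_eq ?_
  ring

/-- Suppose that click shares outside the block are bounded below by `m / (x + m - 1)` with
`x = 1 / (1 - a)`, and that the linear system with coefficients `∑ c, prob c * m g c` expands the
vector `W`. Then a weighted sum `Y` of the `1 / (1 - σ l)` decreases geometrically on average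
where it is large, so that `σ l` stays asymptotically away from `1` if `W l ≠ 0`. -/
theorem exists_bound_lt_one_of_expanding (hs : 0 ≤ s) (hs1 : s ≤ 1) (hκ : ∀ t, 0 < κ t)
    (hκ0 : Tendsto (fun t => 1 / κ t) atTop (𝓝 0)) (hκs : ¬ Summable fun t => 1 / κ t)
    (hσ₀ : IsInterior σ₀) {m : Group → Bool × Bool → ℝ} (hm : ∀ g c, 0 ≤ m g c)
    (hclick : ∀ g c, ∀ a ∈ Set.Ioo (0 : ℝ) 1,
      m g c / (1 / (1 - a) + m g c - 1) ≤ 1 - Q.click g c a)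
    {W : Group → ℝ} (hW : ∀ g, 0 ≤ W g) {η : ℝ} (hη : 0 < η)
    (hWn : ∀ l, (1 + s + η) * W l
      ≤ ∑ g, coupling s l g * ((∑ c, Q.prob c * m g c) * W g))
    {l₀ : Group} (hl₀ : 0 < W l₀) :
    ∃ r ∈ Set.Ico (0 : ℝ) 1,
      Tendsto (fun t => Q.ev s κ σ₀ t fun σ => psq (σ l₀ - r)) atTop (𝓝 0) := by
  set n : Group → ℝ := fun g => ∑ c, Q.prob c * m g c with hn
  set q : Group → ℝ := fun g => ∑ c, Q.prob c * m g c ^ 2 with hq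
  have hn0 : ∀ g, 0 ≤ n g := fun g =>
    Finset.sum_nonneg fun c _ => mul_nonneg (Q.prob_nonneg c) (hm g c)
  have hq0 : ∀ g, 0 ≤ q g := fun g =>
    Finset.sum_nonneg fun c _ => mul_nonneg (Q.prob_nonneg c) (sq_nonneg _)
  obtain ⟨τ, hτ0, hτW⟩ : ∃ τ : ℝ, 0 < τ ∧
      ∀ l, W l = 0 ∨ τ * ∑ g, coupling s l g * W g ≤ η / 2 * W l := by
    have hloc : ∀ l, ∃ τ : ℝ, 0 < τ ∧
        (W l = 0 ∨ τ * ∑ g, coupling s l g * W g ≤ η / 2 * W l) := by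
      intro l
      rcases eq_or_ne (W l) 0 with h | h
      · exact ⟨1, one_pos, Or.inl h⟩
      · have hWl : 0 < W l := lt_of_le_of_ne (hW l) h.symm
        have hS : 0 ≤ ∑ g, coupling s l g * W g :=
          Finset.sum_nonneg fun g _ => mul_nonneg (coupling_nonneg hs l g) (hW g)
        refine ⟨η / 2 * W l / (1 + ∑ g, coupling s l g * W g), by positivity, Or.inr ?_⟩
        rw [div_mul_eq_mul_div, div_le_iff₀ (by linarith)]
        have : 0 ≤ η / 2 * W l := by positivity
        nlinarith
    choose τ hτ0 hτ using hloc
    refine ⟨min (τ Group.A) (τ Group.B), lt_min (hτ0 _) (hτ0 _), fun l => ?_⟩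
    refine (hτ l).imp_right fun h => le_trans (mul_le_mul_of_nonneg_right ?_ ?_) h
    · cases l
      · exact min_le_left _ _
      · exact min_le_right _ _
    · exact Finset.sum_nonneg fun g _ => mul_nonneg (coupling_nonneg hs l g) (hW g)
  set θ : Group → ℝ := fun l => (n l + τ) * W l ^ 3 with hθ
  have hθ0 : ∀ l, 0 ≤ θ l := fun l => by have := hn0 l; have := hW l; positivity
  have hθl₀ : 0 < θ l₀ := by have := hn0 l₀; positivity
  obtain ⟨J, hJ0, hJ⟩ : ∃ J : ℝ, 0 ≤ J ∧ ∀ l g c, m g c * (2 * (W g / W l)) ≤ J := by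
    obtain ⟨J, hJ⟩ := (Set.finite_range fun p : Group × Group × (Bool × Bool) =>
      m p.2.1 p.2.2 * (2 * (W p.2.1 / W p.1))).bddAbove
    exact ⟨max J 0, le_max_right _ _, fun l g c =>
      (hJ ⟨(l, g, c), rfl⟩).trans (le_max_left _ _)⟩
  set K : ℝ := ∑ l, θ l * ∑ g, coupling s l g * ((W g / W l) ^ 2 * q g) with hK
  have hK0 : 0 ≤ K := Finset.sum_nonneg fun l _ => mul_nonneg (hθ0 l) <|
    Finset.sum_nonneg fun g _ => mul_nonneg (coupling_nonneg hs l g)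
      (mul_nonneg (sq_nonneg _) (hq0 g))
  set Y : (Group → ℝ) → ℝ := fun σ => ∑ l, θ l * (1 / (1 - σ l)) with hY
  set y₀ : ℝ := 4 * K / η + 1 + θ l₀ with hy₀
  have hy₀1 : 1 ≤ y₀ := by have : 0 ≤ 4 * K / η := by positivity
                           linarith
  have hy₀θ : θ l₀ ≤ y₀ := by have : 0 ≤ 4 * K / η := by positivity
                              linarith
  have hy₀K : K ≤ η / 4 * y₀ := by
    have h1 : η / 4 * (4 * K / η) = K := by field_simp
    have h2 : 0 ≤ η / 4 * (1 + θ l₀) := by positivity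
    have h3 : η / 4 * y₀ = η / 4 * (4 * K / η) + η / 4 * (1 + θ l₀) := by rw [hy₀]; ring
    linarith
  have hY0 : ∀ σ, IsInterior σ → 0 ≤ Y σ := fun σ hσ => Finset.sum_nonneg fun l _ =>
    mul_nonneg (hθ0 l) (div_nonneg zero_le_one (by linarith [(hσ l).2]))
  -- Bounds on the increment of `Y`, its mean and its size.
  set j : (Group → ℝ) → Group → Draw → ℝ := fun σ l d =>
    max 0 (m d.1 d.2 * (2 * (W d.1 / W l)
      - (W d.1 / W l) ^ 2 * (1 / (1 - σ d.1) + m d.1 d.2 - 1) / (1 / (1 - σ l)))) with hj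
  have hjJ : ∀ σ, IsInterior σ → ∀ l d, j σ l d ≤ J := by
    intro σ hσ l d
    refine max_le hJ0 (le_trans (mul_le_mul_of_nonneg_left ?_ (hm _ _)) (hJ l d.1 d.2))
    have h1 : 0 < 1 - σ l := by linarith [(hσ l).2]
    have h2 : 0 < 1 - σ d.1 := by linarith [(hσ d.1).2]
    have h3 : 1 ≤ 1 / (1 - σ d.1) := by rw [le_div_iff₀ h2]; linarith [(hσ d.1).1]
    have h4 := hm d.1 d.2
    have h5 : 0 ≤ (W d.1 / W l) ^ 2 * (1 / (1 - σ d.1) + m d.1 d.2 - 1) / (1 / (1 - σ l)) := by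
      have : 0 ≤ 1 / (1 - σ d.1) + m d.1 d.2 - 1 := by linarith
      positivity
    linarith
  set Δ : ℝ → (Group → ℝ) → Draw → ℝ := fun ε σ d => ∑ l, θ l * (1 / (1 - σ l) *
    (coupling s l d.1 * (1 - j σ l d) * ε + J ^ 2 * ε ^ 2)) with hΔ
  have hstep : ∀ k, 0 < k → ∀ σ, IsInterior σ → ∀ d,
      Y (Q.update s k d σ) ≤ Y σ + Δ (1 / k) σ d := by
    intro k hk σ hσ d
    rw [hY, hΔ]
    simp only
    rw [← Finset.sum_add_distrib]
    refine Finset.sum_le_sum fun l _ => ?_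
    rw [← mul_add]
    refine mul_le_mul_of_nonneg_left ?_ (hθ0 l)
    have h1 : 0 < 1 - σ l := by linarith [(hσ l).2]
    have h2 : 0 < 1 - σ d.1 := by linarith [(hσ d.1).2]
    have h3 : 1 < 1 / (1 - σ d.1) := by rw [lt_div_iff₀ h2]; linarith [(hσ d.1).1]
    have hx : 0 < 1 / (1 - σ l) := by positivity
    have hc := coupling_nonneg hs l d.1
    have hupd : 1 - Q.update s k d σ l = (k * (1 / (1 / (1 - σ l)))
        + coupling s l d.1 * (1 - Q.click d.1 d.2 (σ d.1))) / (coupling s l d.1 + k) := by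
      have : coupling s l d.1 + k ≠ 0 := by linarith
      rw [update, one_div_one_div]
      field_simp
      ring
    rw [hupd]
    refine inv_step_le hk hc (coupling_le_one hs1 l d.1) hx (le_max_left _ _) (hjJ σ hσ l d) ?_
    have h4 := hclick d.1 d.2 (σ d.1) (hσ d.1)
    have hm' := hm d.1 d.2
    have h5 : 0 < 1 / (1 - σ d.1) + m d.1 d.2 - 1 := by linarith
    refine max_le ?_ (le_trans ?_ (mul_le_mul_of_nonneg_right h4 hx.le))
    · exact mul_nonneg (by linarith [(Q.click_mem_Icc d.1 d.2 (hσ.mem_Icc d.1)).2]) hx.le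
    · generalize 1 / (1 - σ d.1) + m d.1 d.2 - 1 = u at h5 ⊢
      rw [div_mul_eq_mul_div (m d.1 d.2) u, mul_div_assoc (m d.1 d.2)]
      refine mul_le_mul_of_nonneg_left ?_ hm'
      -- `2 z - z² / v ≤ v` for `v = x / u`
      generalize 1 / (1 - σ l) = x at hx ⊢
      generalize W d.1 / W l = z
      have h6 : x / u - (2 * z - z ^ 2 * u / x) = (x - z * u) ^ 2 / (u * x) := by
        field_simp
        ring
      have h7 : 0 ≤ (x - z * u) ^ 2 / (u * x) := by positivity
      linarith
  have hmean : ∀ ε, 0 ≤ ε → ∀ σ, IsInterior σ → ∑ d, Q.weight d * Δ ε σ d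
      ≤ 1 / 2 * ε * (-(η / 2) * Y σ + K) + J ^ 2 * ε ^ 2 * Y σ := by
    intro ε hε σ hσ
    set x : Group → ℝ := fun l => 1 / (1 - σ l) with hx
    have hx1 : ∀ l, 0 < x l := fun l => by
      have : 0 < 1 - σ l := by linarith [(hσ l).2]
      positivity
    have h1 : ∀ d, Δ ε σ d ≤ ∑ l, (θ l * (coupling s l d.1 * x l * ε + x l * (J ^ 2 * ε ^ 2))
        + m d.1 d.2 * (θ l * (coupling s l d.1 * ε
          * (-(2 * (W d.1 / W l) * x l) + (W d.1 / W l) ^ 2 * x d.1)))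
        + m d.1 d.2 ^ 2 * (θ l * (coupling s l d.1 * ε * (W d.1 / W l) ^ 2))) := by
      intro d
      refine Finset.sum_le_sum fun l _ => ?_
      have hxl := hx1 l
      have h2 : m d.1 d.2 * (2 * (W d.1 / W l) * x l
          - (W d.1 / W l) ^ 2 * (x d.1 + m d.1 d.2 - 1)) ≤ x l * j σ l d := by
        have h3 : m d.1 d.2 * (2 * (W d.1 / W l) - (W d.1 / W l) ^ 2 *
            (x d.1 + m d.1 d.2 - 1) / x l) ≤ j σ l d := le_max_right _ _
        refine le_trans (le_of_eq ?_) (mul_le_mul_of_nonneg_left h3 hxl.le)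
        field_simp
      have h3 : 0 ≤ m d.1 d.2 * (W d.1 / W l) ^ 2 := mul_nonneg (hm _ _) (sq_nonneg _)
      have h4 : x l * (1 - j σ l d) ≤ x l + m d.1 d.2 * (-(2 * (W d.1 / W l) * x l)
          + (W d.1 / W l) ^ 2 * x d.1) + m d.1 d.2 ^ 2 * (W d.1 / W l) ^ 2 := by nlinarith
      have h5 : 0 ≤ θ l * (coupling s l d.1 * ε) :=
        mul_nonneg (hθ0 l) (mul_nonneg (coupling_nonneg hs _ _) hε)
      have h6 := mul_le_mul_of_nonneg_left h4 h5
      show θ l * (x l * (coupling s l d.1 * (1 - j σ l d) * ε + J ^ 2 * ε ^ 2)) ≤ _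
      nlinarith
    have h2 : ∑ d, Q.weight d * Δ ε σ d ≤ _ := Finset.sum_le_sum fun d _ =>
      mul_le_mul_of_nonneg_left (h1 d) (weight_nonneg d)
    refine h2.trans ?_
    rw [sum_weight_mul]
    have h3 : ∀ g, ∑ c, Q.prob c * ∑ l, (θ l * (coupling s l g * x l * ε + x l * (J ^ 2 * ε ^ 2))
        + m g c * (θ l * (coupling s l g * ε
          * (-(2 * (W g / W l) * x l) + (W g / W l) ^ 2 * x g)))
        + m g c ^ 2 * (θ l * (coupling s l g * ε * (W g / W l) ^ 2)))
        = ∑ l, (θ l * (coupling s l g * x l * ε + x l * (J ^ 2 * ε ^ 2))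
        + n g * (θ l * (coupling s l g * ε
          * (-(2 * (W g / W l) * x l) + (W g / W l) ^ 2 * x g)))
        + q g * (θ l * (coupling s l g * ε * (W g / W l) ^ 2))) := by
      intro g
      simp only [Finset.mul_sum]
      rw [Finset.sum_comm]
      exact Finset.sum_congr rfl fun l _ => sum_prob_quadratic _ _ _ _
    simp only [h3]
    have h4 := sum_coupling_quadratic_le hs hη hτ0.le hW hn0 (fun g => (hx1 g).le) hWn hτW
    have h5 := mul_le_mul_of_nonneg_left h4 (by positivity : 0 ≤ 1 / 2 * ε)
    have h6 : Y σ = ∑ l, (n l + τ) * W l ^ 3 * x l := rfl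
    rw [h6, hK]
    simp only [hθ]
    simp only [sum_group] at h5 ⊢
    linarith
  set C : ℝ := 1 + J + J ^ 2 with hC
  have hC0 : 0 ≤ C := by positivity
  have hsize : ∀ ε, 0 ≤ ε → ε ≤ 1 → ∀ σ, IsInterior σ → ∀ d, |Δ ε σ d| ≤ C * ε * Y σ := by
    intro ε hε hε1 σ hσ d
    refine (Finset.abs_sum_le_sum_abs _ _).trans ?_
    rw [hY]
    simp only
    rw [Finset.mul_sum]
    refine Finset.sum_le_sum fun l _ => ?_
    have h1 : 0 < 1 - σ l := by linarith [(hσ l).2]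
    have hx : 0 < 1 / (1 - σ l) := by positivity
    rw [abs_mul (θ l), abs_mul (1 / (1 - σ l)), abs_of_nonneg (hθ0 l), abs_of_pos hx]
    have hj0 : 0 ≤ j σ l d := le_max_left _ _
    have hj1 := hjJ σ hσ l d
    have hc := coupling_nonneg hs l d.1
    have hc1 := coupling_le_one hs1 l d.1
    have h2 : |coupling s l d.1 * (1 - j σ l d)| ≤ 1 + J := by
      rw [abs_mul, abs_of_nonneg hc]
      have h3 : |1 - j σ l d| ≤ 1 + J := by rw [abs_le]; constructor <;> linarith
      calc _ ≤ 1 * (1 + J) := mul_le_mul hc1 h3 (abs_nonneg _) zero_le_one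
        _ = _ := one_mul _
    have h3 : |coupling s l d.1 * (1 - j σ l d) * ε + J ^ 2 * ε ^ 2| ≤ C * ε := by
      refine (abs_add_le _ _).trans ?_
      rw [abs_mul, abs_of_nonneg hε, abs_of_nonneg (by positivity : 0 ≤ J ^ 2 * ε ^ 2)]
      have h4 := mul_le_mul_of_nonneg_right h2 hε
      have h5 : J ^ 2 * ε ^ 2 ≤ J ^ 2 * ε := by
        refine mul_le_mul_of_nonneg_left ?_ (sq_nonneg J)
        nlinarith
      rw [hC]
      linarith
    calc _ ≤ θ l * (1 / (1 - σ l) * (C * ε)) :=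
          mul_le_mul_of_nonneg_left (mul_le_mul_of_nonneg_left h3 hx.le) (hθ0 l)
      _ = _ := by ring
  have hmain := tendsto_psq_sub_of_mean_le hs hκ hκ0 hκs hσ₀ hη hy₀1 hy₀K hY0
    (fun t => hstep _ (hκ t)) hmean hsize
  refine ⟨1 - θ l₀ / y₀, ⟨?_, ?_⟩, ?_⟩
  · have := div_le_one_of_le₀ hy₀θ (by linarith)
    linarith
  · have : 0 < θ l₀ / y₀ := by positivity
    linarith
  · refine squeeze_zero (fun t => ev_nonneg hs hκ hσ₀ t fun σ _ => psq_nonneg _)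
      (fun t => ev_mono hs hκ hσ₀ t fun σ hσ => ?_) hmain
    have h1 : 0 < 1 - σ l₀ := by linarith [(hσ l₀).2]
    have hYge : θ l₀ * (1 / (1 - σ l₀)) ≤ Y σ := Finset.single_le_sum
      (f := fun l => θ l * (1 / (1 - σ l))) (fun l _ => mul_nonneg (hθ0 l)
        (div_nonneg zero_le_one (by linarith [(hσ l).2]))) (Finset.mem_univ l₀)
    have h2 : σ l₀ - (1 - θ l₀ / y₀)
        = (1 - σ l₀) / y₀ * (θ l₀ * (1 / (1 - σ l₀)) - y₀) := by
      have : y₀ ≠ 0 := by linarith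
      field_simp
      ring
    have h3 : σ l₀ - (1 - θ l₀ / y₀) ≤ max (Y σ - y₀) 0 := by
      rw [h2]
      have h4 : (1 - σ l₀) / y₀ ≤ 1 := by
        rw [div_le_one (by linarith)]
        linarith [(hσ l₀).1]
      have h5 : 0 ≤ (1 - σ l₀) / y₀ := by positivity
      calc _ ≤ (1 - σ l₀) / y₀ * max (Y σ - y₀) 0 :=
            mul_le_mul_of_nonneg_left (le_trans (by linarith) (le_max_left _ _)) h5
        _ ≤ 1 * max (Y σ - y₀) 0 := mul_le_mul_of_nonneg_right h4 (le_max_right _ _)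
        _ = _ := one_mul _
    refine (psq_mono h3).trans_eq ?_
    rw [psq, psq, max_eq_left (le_max_right _ _)]

end ClickModel

/-- The group that `l` is not. -/
def Group.other : Group → Group
  | .A => .B
  | .B => .A

lemma Group.other_ne (l : Group) : l.other ≠ l := by cases l <;> decide

lemma Group.eq_or_eq_other (l g : Group) : g = l ∨ g = l.other := by
  cases l <;> cases g <;> simp [Group.other]

lemma sum_coupling_mul (s : ℝ) (l : Group) (F : Group → ℝ) :
    ∑ g, coupling s l g * F g = F l + s * F l.other := by
  cases l <;> simp [sum_group, coupling, Group.other, add_comm]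

namespace ClickModel

variable {Q : ClickModel} {s : ℝ} {κ : ℕ → ℝ} {σ₀ : Group → ℝ}

/-- Factor by which the signals `c` multiply the odds of the complement of the block; the infinite
value that occurs if the block has no value is replaced by `T`. -/
noncomputable def oddsFactor (Q : ClickModel) (T : ℝ) (g : Group) (c : Bool × Bool) : ℝ :=
  if Q.wK g c = 0 then T else Q.wL g c / Q.wK g c

lemma oddsFactor_nonneg {T : ℝ} (hT : 0 ≤ T) (g : Group) (c : Bool × Bool) :
    0 ≤ Q.oddsFactor T g c := by
  unfold oddsFactor
  split_ifs
  · exact hT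
  · exact div_nonneg (Q.wL_nonneg g c) (Q.wK_nonneg g c)

lemma click_of_wK_eq_zero {g : Group} {c : Bool × Bool} (h : Q.wK g c = 0) (a : ℝ) :
    Q.click g c a = 0 := by
  have h1 := Q.w_pos g c
  rw [h, zero_add] at h1
  simp [click, share, h, h1.ne']

lemma click_eq_div {g : Group} {c : Bool × Bool} {a : ℝ} (h : Q.wK g c ≠ 0) (ha : 0 < a) :
    Q.click g c a = Q.wK g c * a / (Q.wK g c * a + Q.wL g c * (1 - a)) := by
  unfold click share
  split_ifs with h1
  · rw [h1]; field_simp; simp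
  · rfl

lemma oddsFactor_div_le {T : ℝ} (hT : 0 ≤ T) (g : Group) (c : Bool × Bool) {a : ℝ}
    (ha : a ∈ Set.Ioo (0 : ℝ) 1) :
    Q.oddsFactor T g c / (1 / (1 - a) + Q.oddsFactor T g c - 1) ≤ 1 - Q.click g c a := by
  obtain ⟨h0, h1⟩ := ha
  have h2 : 0 < 1 - a := by linarith
  have h3 : 1 < 1 / (1 - a) := by rw [lt_div_iff₀ h2]; linarith
  by_cases hk : Q.wK g c = 0
  · rw [click_of_wK_eq_zero hk, oddsFactor, if_pos hk, sub_zero]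
    exact div_le_one_of_le₀ (by linarith) (by linarith)
  · have hk0 : 0 < Q.wK g c := lt_of_le_of_ne (Q.wK_nonneg g c) (Ne.symm hk)
    have hl0 := Q.wL_nonneg g c
    rw [click_eq_div hk h0, oddsFactor, if_neg hk]
    apply le_of_eq
    have hD : 0 < Q.wK g c * a + Q.wL g c * (1 - a) := by positivity
    have h5 : 1 / (1 - a) + Q.wL g c / Q.wK g c - 1
        = (Q.wK g c * a + Q.wL g c * (1 - a)) / ((1 - a) * Q.wK g c) := by
      field_simp; ring
    rw [h5, one_sub_div hD.ne']
    field_simp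
    ring

/-- Odds are a convex function: the right-hand side is an average of the odds of the click shares
outside the block, the left-hand side the average of the values on the tangent at `1 - u`, with a
gain from the click share `0`. -/
lemma le_sum_oddsFactor_mul {T u a : ℝ} (hu : 0 < u) (ha : a ∈ Set.Ioo (0 : ℝ) 1)
    {g : Group} (hTa : (1 - u) / u + 1 / u ≤ T * ((1 - a) / a)) :
    (1 - u) / u + (u - Q.resp g a) / u ^ 2 + Q.prob Q.sure * ((1 - u) / u) ^ 2
      ≤ (∑ c, Q.prob c * Q.oddsFactor T g c) * ((1 - a) / a) := by
  obtain ⟨h0, h1⟩ := ha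
  have h2 : 0 < 1 - a := by linarith
  have hc : ∀ c, (1 - u) / u + (u - Q.click g c a) / u ^ 2
      ≤ Q.oddsFactor T g c * ((1 - a) / a) := by
    intro c
    by_cases hk : Q.wK g c = 0
    · rw [click_of_wK_eq_zero hk, oddsFactor, if_pos hk, sub_zero]
      have : u / u ^ 2 = 1 / u := by field_simp
      rwa [this]
    · have hk0 : 0 < Q.wK g c := lt_of_le_of_ne (Q.wK_nonneg g c) (Ne.symm hk)
      have hl0 := Q.wL_nonneg g c
      have hD : 0 < Q.wK g c * a + Q.wL g c * (1 - a) := by positivity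
      have hy := click_eq_div hk h0
      have hy0 : 0 < Q.click g c a := by rw [hy]; positivity
      have h3 : Q.oddsFactor T g c * ((1 - a) / a) = 1 / Q.click g c a - 1 := by
        rw [hy, oddsFactor, if_neg hk]
        field_simp
        ring
      rw [h3]
      generalize Q.click g c a = y at hy0
      have h4 : 1 / y - 1 - ((1 - u) / u + (u - y) / u ^ 2) = (u - y) ^ 2 / (u ^ 2 * y) := by
        field_simp
        ring
      have h5 : 0 ≤ (u - y) ^ 2 / (u ^ 2 * y) := by positivity
      linarith
  have hsure : (1 - u) / u + (u - Q.click g Q.sure a) / u ^ 2 + ((1 - u) / u) ^ 2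
      ≤ Q.oddsFactor T g Q.sure * ((1 - a) / a) := by
    have hk : Q.wK g Q.sure ≠ 0 := by
      have := Q.w_pos g Q.sure
      rw [Q.wL_sure, add_zero] at this
      exact this.ne'
    rw [click_sure, oddsFactor, if_neg hk, Q.wL_sure, zero_div, zero_mul]
    apply le_of_eq
    field_simp
    ring
  classical
  have hsum : ∑ c, Q.prob c * ((1 - u) / u + (u - Q.click g c a) / u ^ 2
        + if c = Q.sure then ((1 - u) / u) ^ 2 else 0)
      ≤ (∑ c, Q.prob c * Q.oddsFactor T g c) * ((1 - a) / a) := by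
    rw [Finset.sum_mul]
    refine Finset.sum_le_sum fun c _ => ?_
    rw [mul_assoc]
    refine mul_le_mul_of_nonneg_left ?_ (Q.prob_nonneg c)
    split_ifs with h
    · rw [h]; exact hsure
    · rw [add_zero]; exact hc c
  refine le_trans (le_of_eq ?_) hsum
  have h6 : ∀ c, Q.prob c * ((1 - u) / u + (u - Q.click g c a) / u ^ 2
        + if c = Q.sure then ((1 - u) / u) ^ 2 else 0)
      = Q.prob c * ((1 - u) / u + u / u ^ 2) - (1 / u ^ 2) * (Q.prob c * Q.click g c a)
        + if c = Q.sure then Q.prob c * ((1 - u) / u) ^ 2 else 0 := by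
    intro c
    split_ifs <;> ring
  simp only [h6, Finset.sum_add_distrib, Finset.sum_sub_distrib, Q.sum_prob_mul, ← Finset.mul_sum,
    Finset.sum_ite_eq', Finset.mem_univ, if_true, resp]
  ring

lemma expanding_of_drift_nonpos {T : ℝ} (hs : 0 ≤ s) {c : Group → ℝ}
    (hc : ∀ g, c g ∈ Set.Ioo (0 : ℝ) 1) (hd : ∀ g, Q.drift s c g ≤ 0)
    (hT : ∀ l g, (1 - c l) / c l + 1 / c l ≤ T * ((1 - c g) / c g)) (l : Group) :
    (1 + s + Q.prob Q.sure * ((1 - c l) / c l)) * ((1 - c l) / c l)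
      ≤ ∑ g, coupling s l g * ((∑ i, Q.prob i * Q.oddsFactor T g i) * ((1 - c g) / c g)) := by
  have h0 := (hc l).1
  have h1 : ∑ g, coupling s l g * ((1 - c l) / c l + (c l - Q.resp g (c g)) / c l ^ 2
        + Q.prob Q.sure * ((1 - c l) / c l) ^ 2)
      ≤ ∑ g, coupling s l g * ((∑ i, Q.prob i * Q.oddsFactor T g i) * ((1 - c g) / c g)) :=
    Finset.sum_le_sum fun g _ => mul_le_mul_of_nonneg_left
      (le_sum_oddsFactor_mul h0 (hc g) (hT l g)) (coupling_nonneg hs l g)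
  refine le_trans ?_ h1
  have h2 : ∑ g, coupling s l g * ((1 - c l) / c l + (c l - Q.resp g (c g)) / c l ^ 2
        + Q.prob Q.sure * ((1 - c l) / c l) ^ 2)
      = (1 + s) * ((1 - c l) / c l + Q.prob Q.sure * ((1 - c l) / c l) ^ 2)
        - Q.drift s c l / c l ^ 2 := by
    rw [drift, Finset.sum_div, ← coupling_sum s l, Finset.sum_mul, ← Finset.sum_sub_distrib]
    refine Finset.sum_congr rfl fun g _ => ?_
    ring
  rw [h2]
  have h3 : Q.drift s c l / c l ^ 2 ≤ 0 := div_nonpos_of_nonpos_of_nonneg (hd l) (sq_nonneg _)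
  have h4 : 0 ≤ s * (Q.prob Q.sure * ((1 - c l) / c l) ^ 2) :=
    mul_nonneg hs (mul_nonneg (Q.prob_nonneg _) (sq_nonneg _))
  nlinarith

/-- For `s > 0` a superequilibrium that is not full concentration can be moved to the interior. -/
lemma exists_interior_drift_nonpos (hs : 0 < s) {c : Group → ℝ}
    (hc : ∀ g, c g ∈ Set.Ioc (0 : ℝ) 1) (hd : ∀ g, Q.drift s c g ≤ 0) {l : Group} (hl : c l < 1) :
    ∃ c' : Group → ℝ, (∀ g, c' g ∈ Set.Ioo (0 : ℝ) 1) ∧ ∀ g, Q.drift s c' g ≤ 0 := by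
  have hcI : ∀ g, c g ∈ Set.Icc (0 : ℝ) 1 := fun g => ⟨(hc g).1.le, (hc g).2⟩
  rcases (hc l.other).2.lt_or_eq with ho | ho
  · refine ⟨c, fun g => ⟨(hc g).1, ?_⟩, hd⟩
    rcases l.eq_or_eq_other g with rfl | rfl <;> assumption
  · have h1I : (1 : ℝ) ∈ Set.Icc (0 : ℝ) 1 := by simp
    have hr1 := (Q.resp_mem_Icc l.other h1I).2
    have hr2 := (Q.resp_mem_Icc l (hcI l)).2
    have hlt : Q.resp l.other 1 + s * Q.resp l (c l) < 1 + s := by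
      by_contra hcon
      have h2 := hd l
      rw [drift_eq, sum_coupling_mul, ho] at h2
      push Not at hcon
      have h3 : s * Q.resp l (c l) ≤ s * 1 := mul_le_mul_of_nonneg_left hr2 hs.le
      have h4 : s * Q.resp l.other 1 ≤ s * 1 := mul_le_mul_of_nonneg_left hr1 hs.le
      have h5 : 1 ≤ Q.resp l (c l) := le_of_mul_le_mul_left (by linarith) hs
      have h6 : s * 1 ≤ s * Q.resp l.other 1 := mul_le_mul_of_nonneg_left (by linarith) hs.le
      nlinarith
    set r : ℝ := max ((Q.resp l.other 1 + s * Q.resp l (c l)) / (1 + s)) (1 / 2) with hr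
    have hr0 : 0 < r := lt_of_lt_of_le (by norm_num) (le_max_right _ _)
    have hrlt : r < 1 := max_lt ((div_lt_one (by linarith)).2 hlt) (by norm_num)
    have hrge : Q.resp l.other 1 + s * Q.resp l (c l) ≤ (1 + s) * r := by
      have := le_max_left ((Q.resp l.other 1 + s * Q.resp l (c l)) / (1 + s)) (1 / 2)
      rw [← hr, div_le_iff₀ (by linarith)] at this
      linarith
    set c' : Group → ℝ := fun g => if g = l then c l else r with hc'
    have hc'l : c' l = c l := by simp [hc']
    have hc'o : c' l.other = r := by simp [hc', l.other_ne]
    have hc'I : ∀ g, c' g ∈ Set.Ioo (0 : ℝ) 1 := by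
      intro g
      rcases l.eq_or_eq_other g with rfl | rfl
      · rw [hc'l]; exact ⟨(hc _).1, hl⟩
      · rw [hc'o]; exact ⟨hr0, hrlt⟩
    refine ⟨c', hc'I, fun g => ?_⟩
    rcases l.eq_or_eq_other g with rfl | rfl
    · refine (Q.drift_mono hs.le (fun g => ⟨(hc'I g).1.le, (hc'I g).2.le⟩) hcI (fun g' => ?_)
        hc'l).trans (hd _)
      rcases g.eq_or_eq_other g' with rfl | rfl
      · exact hc'l.le
      · rw [hc'o, ho]; exact hrlt.le
    · rw [drift_eq, sum_coupling_mul]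
      have hoo : l.other.other = l := by cases l <;> rfl
      rw [hoo, hc'o, hc'l]
      have := Q.resp_mono l.other ⟨hr0.le, hrlt.le⟩ h1I hrlt.le
      linarith

/-- If some superequilibrium has `c l < 1`, then `σ l` stays asymptotically away from `1`. -/
theorem exists_bound_lt_one (hs : 0 ≤ s) (hs1 : s ≤ 1) (hκ : ∀ t, 0 < κ t)
    (hκ0 : Tendsto (fun t => 1 / κ t) atTop (𝓝 0)) (hκs : ¬ Summable fun t => 1 / κ t)
    (hσ₀ : IsInterior σ₀) {c : Group → ℝ} (hc : ∀ g, c g ∈ Set.Ioc (0 : ℝ) 1)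
    (hd : ∀ g, Q.drift s c g ≤ 0) {l : Group} (hl : c l < 1) :
    ∃ r ∈ Set.Ico (0 : ℝ) 1,
      Tendsto (fun t => Q.ev s κ σ₀ t fun σ => psq (σ l - r)) atTop (𝓝 0) := by
  have hWpos : ∀ {x : ℝ}, 0 < x → x < 1 → 0 < (1 - x) / x := fun h0 h1 =>
    div_pos (by linarith) h0
  rcases hs.eq_or_lt with h0 | hpos
  · -- Decoupled groups: only the coordinate `l` enters.
    subst h0
    set W : Group → ℝ := fun g => if g = l then (1 - c l) / c l else 0 with hW
    have hWl : W l = (1 - c l) / c l := by simp [hW]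
    have hWo : W l.other = 0 := by simp [hW, l.other_ne]
    have hW1 := hWpos (hc l).1 hl
    set T : ℝ := ((1 - c l) / c l + 1 / c l) / ((1 - c l) / c l) with hT
    have hcl := (hc l).1
    have hT0 : 0 ≤ T := by positivity
    refine exists_bound_lt_one_of_expanding le_rfl zero_le_one hκ hκ0 hκs hσ₀
      (m := Q.oddsFactor T) (oddsFactor_nonneg hT0) (fun g i a ha => oddsFactor_div_le hT0 g i ha)
      (W := W) (fun g => ?_) (η := Q.prob Q.sure * ((1 - c l) / c l)) (mul_pos Q.sure_pos hW1)
      (fun g => ?_) (l₀ := l) (by rw [hWl]; exact hW1)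
    · rcases l.eq_or_eq_other g with rfl | rfl
      · rw [hWl]; exact hW1.le
      · rw [hWo]
    · rw [sum_coupling_mul, zero_mul, add_zero]
      rcases l.eq_or_eq_other g with rfl | rfl
      · rw [hWl]
        have h1 := le_sum_oddsFactor_mul (Q := Q) (T := T) (g := g) (hc g).1 ⟨(hc g).1, hl⟩
          (by rw [hT, div_mul_cancel₀ _ hW1.ne'])
        have h2 := hd g
        rw [drift, sum_coupling_mul, zero_mul, add_zero] at h2
        have h3 : 0 ≤ (c g - Q.resp g (c g)) / c g ^ 2 := div_nonneg (by linarith) (sq_nonneg _)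
        nlinarith
      · simp [hWo]
  · obtain ⟨c', hc', hd'⟩ := exists_interior_drift_nonpos hpos hc hd hl
    have hW1 : ∀ g, 0 < (1 - c' g) / c' g := fun g => hWpos (hc' g).1 (hc' g).2
    obtain ⟨T, hT⟩ := (Set.finite_range fun p : Group × Group =>
      ((1 - c' p.1) / c' p.1 + 1 / c' p.1) / ((1 - c' p.2) / c' p.2)).bddAbove
    have hT' : ∀ l g, (1 - c' l) / c' l + 1 / c' l ≤ T * ((1 - c' g) / c' g) := by
      intro l g
      rw [← div_le_iff₀ (hW1 g)]
      exact hT ⟨(l, g), rfl⟩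
    have hT0 : 0 ≤ T := by
      have h1 := hT' l l
      have h2 := hW1 l
      have h3 : 0 < 1 / c' l := one_div_pos.2 (hc' l).1
      by_contra h
      nlinarith
    set η : ℝ := Q.prob Q.sure *
      min ((1 - c' Group.A) / c' Group.A) ((1 - c' Group.B) / c' Group.B) with hη
    refine exists_bound_lt_one_of_expanding hs hs1 hκ hκ0 hκs hσ₀
      (m := Q.oddsFactor T) (oddsFactor_nonneg hT0) (fun g i a ha => oddsFactor_div_le hT0 g i ha)
      (W := fun g => (1 - c' g) / c' g) (fun g => (hW1 g).le) (η := η)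
      (mul_pos Q.sure_pos (lt_min (hW1 _) (hW1 _))) (fun g => ?_) (hW1 l)
    refine le_trans (mul_le_mul_of_nonneg_right ?_ (hW1 g).le)
      (expanding_of_drift_nonpos hs hc' hd' hT' g)
    have : min ((1 - c' Group.A) / c' Group.A) ((1 - c' Group.B) / c' Group.B)
        ≤ (1 - c' g) / c' g := by
      cases g
      · exact min_le_left _ _
      · exact min_le_right _ _
    have := mul_le_mul_of_nonneg_left this (Q.prob_nonneg Q.sure)
    linarith

/-! ### Convergence of the chain -/

/-- Each coordinate has a best asymptotic bound, from above if `ς = 1` and from below if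
`ς = -1`. -/
lemma exists_best_bound (hs : 0 ≤ s) (hκ : ∀ t, 0 < κ t) (hσ₀ : IsInterior σ₀) {ς : ℝ}
    (hς : ς = 1 ∨ ς = -1) (l : Group) :
    ∃ u ∈ Set.Icc (0 : ℝ) 1,
      Tendsto (fun t => Q.ev s κ σ₀ t fun σ => psq (ς * (σ l - u))) atTop (𝓝 0) ∧
      ∀ δ, 0 < δ →
        ¬ Tendsto (fun t => Q.ev s κ σ₀ t fun σ => psq (ς * (σ l - u) + δ)) atTop (𝓝 0) := by
  set u₀ : ℝ := (1 + ς) / 2 with hu₀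
  have hx : ∀ σ : Group → ℝ, IsInterior σ → -1 ≤ ς * (σ l - u₀) ∧ ς * (σ l - u₀) ≤ 0 := by
    intro σ hσ
    have h := hσ l
    rcases hς with h' | h' <;> rw [hu₀, h'] <;> constructor <;> linarith [h.1, h.2]
  set S : Set ℝ := {β | Tendsto (fun t => Q.ev s κ σ₀ t fun σ => psq (ς * (σ l - u₀) + β))
    atTop (𝓝 0)} with hS
  have h0S : (0 : ℝ) ∈ S := by
    refine squeeze_zero (fun t => ev_nonneg hs hκ hσ₀ t fun σ _ => psq_nonneg _)
      (fun t => (ev_mono hs hκ hσ₀ t (ψ := fun _ => 0) fun σ hσ => ?_).trans_eq (ev_const t 0))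
      tendsto_const_nhds
    have h1 := (hx σ hσ).2
    rw [psq, max_eq_right (by linarith)]
    simp
  have hS1 : ∀ β ∈ S, β ≤ 1 := by
    intro β hβ
    by_contra! h
    have h1 : (β - 1) ^ 2 ≤ 0 := by
      refine ge_of_tendsto hβ (Eventually.of_forall fun t => ?_)
      rw [← ev_const (Q := Q) (s := s) (κ := κ) (σ₀ := σ₀) t ((β - 1) ^ 2)]
      refine ev_mono hs hκ hσ₀ t fun σ hσ => ?_
      have h2 := (hx σ hσ).1
      rw [psq, max_eq_left (by linarith)]
      exact pow_le_pow_left₀ (by linarith) (by linarith) 2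
    nlinarith
  have hbdd : BddAbove S := ⟨1, hS1⟩
  set β := sSup S with hβ
  have hβ0 : 0 ≤ β := le_csSup hbdd h0S
  have hβ1 : β ≤ 1 := csSup_le ⟨0, h0S⟩ hS1
  have hςς : ς * ς = 1 := by rcases hς with h | h <;> rw [h] <;> norm_num
  have hre : ∀ (σ : Group → ℝ) (δ : ℝ),
      ς * (σ l - (u₀ - ς * β)) + δ = ς * (σ l - u₀) + (β + δ) := by
    intro σ δ
    linear_combination β * hςς
  refine ⟨u₀ - ς * β, ?_, ?_, fun δ hδ h => ?_⟩
  · rcases hς with h | h <;> rw [hu₀, h] <;> constructor <;> linarith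
  · rw [Metric.tendsto_atTop]
    intro e he
    obtain ⟨δ, hδ0, hδe⟩ : ∃ δ : ℝ, 0 < δ ∧ 2 * δ ^ 2 < e / 2 := by
      refine ⟨min 1 (e / 8), lt_min one_pos (by positivity), ?_⟩
      have h1 : min 1 (e / 8) ≤ 1 := min_le_left _ _
      have h2 : min 1 (e / 8) ≤ e / 8 := min_le_right _ _
      have h3 : 0 < min 1 (e / 8) := lt_min one_pos (by positivity)
      nlinarith
    obtain ⟨β', hβ'S, hβ'⟩ := exists_lt_of_lt_csSup ⟨0, h0S⟩ (sub_lt_self β hδ0)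
    have hT : Tendsto (fun t => Q.ev s κ σ₀ t fun σ => psq (ς * (σ l - u₀) + β')) atTop (𝓝 0) :=
      hβ'S
    obtain ⟨N, hN⟩ := eventually_atTop.1 (hT.eventually_lt_const (by positivity : 0 < e / 4))
    refine ⟨N, fun t ht => ?_⟩
    have hnn := ev_nonneg (Q := Q) hs hκ hσ₀ t
      (φ := fun σ => psq (ς * (σ l - (u₀ - ς * β)))) fun σ _ => psq_nonneg _
    rw [Real.dist_eq, sub_zero, abs_of_nonneg hnn]
    have hle : Q.ev s κ σ₀ t (fun σ => psq (ς * (σ l - (u₀ - ς * β))))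
        ≤ Q.ev s κ σ₀ t (fun σ => 2 * psq (ς * (σ l - u₀) + β') + 2 * δ ^ 2) := by
      refine ev_mono hs hκ hσ₀ t fun σ _ => ?_
      have h1 := hre σ 0
      rw [add_zero, add_zero] at h1
      rw [h1, psq, psq]
      have h2 : max (ς * (σ l - u₀) + β) 0 ≤ max (ς * (σ l - u₀) + β') 0 + δ :=
        max_le (by linarith [le_max_left (ς * (σ l - u₀) + β') 0])
          (by linarith [le_max_right (ς * (σ l - u₀) + β') 0])
      have h3 := pow_le_pow_left₀ (le_max_right _ _) h2 2
      nlinarith [sq_nonneg (max (ς * (σ l - u₀) + β') 0 - δ)]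
    rw [ev_add, ev_const_mul, ev_const] at hle
    have := hN t ht
    linarith
  · have h1 : β + δ ∈ S := by
      simp only [hre] at h
      exact h
    linarith [le_csSup hbdd h1]

variable (Q) in
/-- The asymptotic state of the chain: an equilibrium, equal to `1` only in coordinates where every
superequilibrium is. -/
structure IsAttractor (s : ℝ) (X : Group → ℝ) : Prop where
  mem : ∀ l, X l ∈ Set.Ioc (0 : ℝ) 1
  drift_eq_zero : ∀ l, Q.drift s X l = 0
  lt_one : ∀ l (c : Group → ℝ), (∀ g, c g ∈ Set.Ioc (0 : ℝ) 1) → (∀ g, Q.drift s c g ≤ 0) →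
    c l < 1 → X l < 1

/-- The best asymptotic lower and upper bounds of the chain are a super- and a subequilibrium, so
they coincide. -/
theorem exists_isAttractor_tendsto (hs : 0 ≤ s) (hs1 : s ≤ 1) (hκ : ∀ t, 0 < κ t)
    (hκ0 : Tendsto (fun t => 1 / κ t) atTop (𝓝 0)) (hκs : ¬ Summable fun t => 1 / κ t)
    (hσ₀ : IsInterior σ₀) :
    ∃ X : Group → ℝ, Q.IsAttractor s X ∧
      ∀ l, Tendsto (fun t => Q.ev s κ σ₀ t fun σ => (σ l - X l) ^ 2) atTop (𝓝 0) := by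
  choose lo hloI hlo hlomax using
    fun l => exists_best_bound (Q := Q) hs hκ hσ₀ (Or.inr (rfl : (-1 : ℝ) = -1)) l
  choose up hupI hup hupmax using
    fun l => exists_best_bound (Q := Q) hs hκ hσ₀ (Or.inl (rfl : (1 : ℝ) = 1)) l
  have hlod : ∀ l, Q.drift s lo l ≤ 0 := by
    intro l
    by_contra! h
    obtain ⟨δ, hδ, hT⟩ := exists_better_bound hs hs1 hκ hκ0 hκs hσ₀ (Or.inr rfl) hloI hlo
      (l := l) (by linarith)
    exact hlomax l δ hδ hT
  have hupd : ∀ l, 0 ≤ Q.drift s up l := by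
    intro l
    by_contra! h
    obtain ⟨δ, hδ, hT⟩ := exists_better_bound hs hs1 hκ hκ0 hκs hσ₀ (Or.inl rfl) hupI hup
      (l := l) (by linarith)
    exact hupmax l δ hδ hT
  have hlo0 : ∀ l, 0 < lo l := by
    intro l
    refine lt_of_le_of_ne (hloI l).1 fun h => ?_
    have := Q.drift_pos_of_eq_zero hs hloI h.symm
    linarith [hlod l]
  have hle : ∀ l, lo l ≤ up l := by
    intro l
    by_contra! h
    have hsum := (hlo l).add (hup l)
    rw [add_zero] at hsum
    have h1 : (lo l - up l) ^ 2 / 2 ≤ 0 := by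
      refine ge_of_tendsto hsum (Eventually.of_forall fun t => ?_)
      rw [← ev_add, ← ev_const (Q := Q) (s := s) (κ := κ) (σ₀ := σ₀) t ((lo l - up l) ^ 2 / 2)]
      refine ev_mono hs hκ hσ₀ t fun σ _ => ?_
      have h2 : lo l - up l ≤ max (-1 * (σ l - lo l)) 0 + max (1 * (σ l - up l)) 0 := by
        linarith [le_max_left (-1 * (σ l - lo l)) 0, le_max_left (1 * (σ l - up l)) 0]
      have h3 := pow_le_pow_left₀ (by linarith) h2 2
      rw [psq, psq]
      nlinarith [sq_nonneg (max (-1 * (σ l - lo l)) 0 - max (1 * (σ l - up l)) 0)]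
    have h2 : 0 < (lo l - up l) ^ 2 := by
      have : 0 < lo l - up l := by linarith
      positivity
    linarith
  have hup1 : ∀ l (c : Group → ℝ), (∀ g, c g ∈ Set.Ioc (0 : ℝ) 1) → (∀ g, Q.drift s c g ≤ 0) →
      c l < 1 → up l < 1 := by
    intro l c hc hd hl
    refine lt_of_le_of_ne (hupI l).2 fun h => ?_
    obtain ⟨r, hr, hT⟩ := exists_bound_lt_one hs hs1 hκ hκ0 hκs hσ₀ hc hd hl
    refine hupmax l (1 - r) (by linarith [hr.2]) ?_
    have : ∀ σ : Group → ℝ, 1 * (σ l - up l) + (1 - r) = σ l - r := fun σ => by rw [h]; ring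
    simpa only [this] using hT
  have heq := Q.eq_of_drift_nonpos_of_drift_nonneg hs (fun g => ⟨hlo0 g, (hloI g).2⟩)
    (fun g => ⟨(hlo0 g).trans_le (hle g), (hupI g).2⟩) hle
    (fun g => hup1 g lo (fun g => ⟨hlo0 g, (hloI g).2⟩) hlod) hlod hupd
  subst heq
  refine ⟨lo, ⟨fun l => ⟨hlo0 l, (hloI l).2⟩, fun l => le_antisymm (hlod l) (hupd l), hup1⟩,
    fun l => ?_⟩
  have hsum := (hlo l).add (hup l)
  rw [add_zero] at hsum
  refine hsum.congr fun t => ?_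
  rw [← ev_add]
  congr 1
  funext σ
  rw [psq, psq]
  rcases le_total (σ l) (lo l) with h | h
  · rw [max_eq_left (by linarith), max_eq_right (by linarith)]; ring
  · rw [max_eq_right (by linarith), max_eq_left (by linarith)]; ring

lemma tendsto_ev_resp (hs : 0 ≤ s) (hκ : ∀ t, 0 < κ t) (hσ₀ : IsInterior σ₀) {l : Group} {x : ℝ}
    (hx : x ∈ Set.Icc (0 : ℝ) 1)
    (h : Tendsto (fun t => Q.ev s κ σ₀ t fun σ => (σ l - x) ^ 2) atTop (𝓝 0)) :
    Tendsto (fun t => Q.ev s κ σ₀ t fun σ => Q.resp l (σ l)) atTop (𝓝 (Q.resp l x)) := by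
  obtain ⟨C, hC0, hC⟩ := Q.exists_resp_lipschitz
  rw [Metric.tendsto_atTop]
  intro e he
  set D : ℝ := C ^ 2 / (2 * e) with hD
  have hD0 : 0 ≤ D := by positivity
  obtain ⟨N, hN⟩ := eventually_atTop.1 (h.eventually_lt_const (by positivity : 0 < e / (4 * (D + 1))))
  refine ⟨N, fun t ht => ?_⟩
  have hpt : ∀ σ, IsInterior σ → |Q.resp l (σ l) - Q.resp l x| ≤ e / 2 + D * (σ l - x) ^ 2 := by
    intro σ hσ
    have h1 : |Q.resp l (σ l) - Q.resp l x| ≤ C * |σ l - x| := by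
      rcases le_total (σ l) x with h | h
      · have := hC l _ (hσ.mem_Icc l) _ hx h
        rw [abs_sub_comm, abs_of_nonneg this.1, abs_sub_comm, abs_of_nonneg (sub_nonneg.2 h)]
        exact this.2
      · have := hC l _ hx _ (hσ.mem_Icc l) h
        rw [abs_of_nonneg this.1, abs_of_nonneg (sub_nonneg.2 h)]
        exact this.2
    have h2 : e / 2 + D * (σ l - x) ^ 2 - C * |σ l - x| = (e - C * |σ l - x|) ^ 2 / (2 * e) := by
      rw [hD, ← sq_abs (σ l - x)]
      field_simp
      ring
    have h3 : 0 ≤ (e - C * |σ l - x|) ^ 2 / (2 * e) := by positivity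
    linarith
  have h1 := ev_mono (Q := Q) hs hκ hσ₀ t (φ := fun σ => Q.resp l (σ l))
    (ψ := fun σ => (Q.resp l x + e / 2) + D * (σ l - x) ^ 2) fun σ hσ => by
      have := (abs_le.1 (hpt σ hσ)).2; linarith
  have h2 := ev_mono (Q := Q) hs hκ hσ₀ t (ψ := fun σ => Q.resp l (σ l))
    (φ := fun σ => (Q.resp l x - e / 2) + (-D) * (σ l - x) ^ 2) fun σ hσ => by
      have := (abs_le.1 (hpt σ hσ)).1; linarith
  rw [ev_add, ev_const_mul, ev_const] at h1 h2
  have h3 := hN t ht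
  rw [lt_div_iff₀ (by positivity)] at h3
  have h4 := ev_nonneg (Q := Q) hs hκ hσ₀ t (φ := fun σ => (σ l - x) ^ 2) fun σ _ => sq_nonneg _
  rw [Real.dist_eq, abs_lt]
  constructor <;> nlinarith

end ClickModel

namespace ClickModel

variable (Q : ClickModel) {s : ℝ}

/-! ### The energy function -/

/-- Primitive of the response function. -/
noncomputable def primitive (g : Group) (a : ℝ) : ℝ := ∫ x in (0 : ℝ)..a, Q.resp g x

/-- Energy of a state, as for a Hopfield network with symmetric interaction matrix
`coupling s / (1 + s)`. The parameter `s` enters only as the coefficient of the squared difference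
of the two responses. -/
noncomputable def energy (s : ℝ) (σ : Group → ℝ) : ℝ :=
  ∑ g, (σ g * Q.resp g (σ g) - Q.primitive g (σ g) - Q.resp g (σ g) ^ 2 / 2)
    + s / (2 * (1 + s)) * (Q.resp Group.A (σ Group.A) - Q.resp Group.B (σ Group.B)) ^ 2

/-- The map whose fixed points are the zeros of the drift. -/
noncomputable def reply (s : ℝ) (σ : Group → ℝ) (l : Group) : ℝ :=
  (∑ g, coupling s l g * Q.resp g (σ g)) / (1 + s)

variable {Q}

lemma intervalIntegrable_resp (g : Group) {a b : ℝ} (ha : a ∈ Set.Icc (0 : ℝ) 1)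
    (hb : b ∈ Set.Icc (0 : ℝ) 1) : IntervalIntegrable (Q.resp g) volume a b :=
  ((Q.continuousOn_resp g).mono (Set.uIcc_subset_Icc ha hb)).intervalIntegrable

/-- The primitive is convex, since the response is nondecreasing. -/
lemma primitive_tangent (g : Group) {a b : ℝ} (ha : a ∈ Set.Icc (0 : ℝ) 1)
    (hb : b ∈ Set.Icc (0 : ℝ) 1) :
    Q.resp g a * (b - a) ≤ Q.primitive g b - Q.primitive g a := by
  have h0 : (0 : ℝ) ∈ Set.Icc (0 : ℝ) 1 := by simp
  rw [primitive, primitive, intervalIntegral.integral_interval_sub_left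
    (intervalIntegrable_resp g h0 hb) (intervalIntegrable_resp g h0 ha)]
  rcases le_total a b with h | h
  · have h1 := intervalIntegral.integral_mono_on h
      (intervalIntegrable_const (c := Q.resp g a)) (intervalIntegrable_resp g ha hb)
      fun x hx => Q.resp_mono g ha ⟨ha.1.trans hx.1, hx.2.trans hb.2⟩ hx.1
    rw [intervalIntegral.integral_const, smul_eq_mul] at h1
    linarith
  · have h1 := intervalIntegral.integral_mono_on h (intervalIntegrable_resp g hb ha)
      (intervalIntegrable_const (c := Q.resp g a))
      fun x hx => Q.resp_mono g ⟨hb.1.trans hx.1, hx.2.trans ha.2⟩ ha hx.2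
    rw [intervalIntegral.integral_const, smul_eq_mul] at h1
    rw [intervalIntegral.integral_symm]
    linarith

lemma continuousOn_primitive (g : Group) : ContinuousOn (Q.primitive g) (Set.Icc 0 1) := by
  refine (LipschitzOnWith.of_dist_le_mul (K := 1) fun x hx y hy => ?_).continuousOn
  show |_| ≤ 1 * |_|
  rw [one_mul]
  have h1 := primitive_tangent (Q := Q) g hx hy
  have h2 := primitive_tangent (Q := Q) g hy hx
  have hx' := Q.resp_mem_Icc g hx
  have hy' := Q.resp_mem_Icc g hy
  have h3 : |Q.resp g x * (y - x)| ≤ |x - y| := by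
    rw [abs_mul, abs_of_nonneg hx'.1, abs_sub_comm]
    exact mul_le_of_le_one_left (abs_nonneg _) hx'.2
  have h4 : |Q.resp g y * (x - y)| ≤ |x - y| := by
    rw [abs_mul, abs_of_nonneg hy'.1]
    exact mul_le_of_le_one_left (abs_nonneg _) hy'.2
  rw [abs_le] at h3 h4 ⊢
  constructor <;> linarith [h3.1, h3.2, h4.1, h4.2]

lemma continuousOn_energy (s : ℝ) :
    ContinuousOn (Q.energy s) {σ | ∀ g, σ g ∈ Set.Icc (0 : ℝ) 1} := by
  have hr : ∀ g, ContinuousOn (fun σ : Group → ℝ => Q.resp g (σ g))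
      {σ | ∀ g, σ g ∈ Set.Icc (0 : ℝ) 1} := fun g =>
    (Q.continuousOn_resp g).comp (continuous_apply g).continuousOn fun σ hσ => hσ g
  have hp : ∀ g, ContinuousOn (fun σ : Group → ℝ => Q.primitive g (σ g))
      {σ | ∀ g, σ g ∈ Set.Icc (0 : ℝ) 1} := fun g =>
    (continuousOn_primitive g).comp (continuous_apply g).continuousOn fun σ hσ => hσ g
  refine ContinuousOn.add (continuousOn_finsetSum _ fun g _ => ?_) ?_
  · exact (((continuous_apply g).continuousOn.mul (hr g)).sub (hp g)).sub
      (((hr g).pow 2).div_const 2)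
  · exact (((hr _).sub (hr _)).pow 2).const_smul (s / (2 * (1 + s)))

lemma reply_eq (s : ℝ) (σ : Group → ℝ) (l : Group) :
    Q.reply s σ l = (Q.resp l (σ l) + s * Q.resp l.other (σ l.other)) / (1 + s) := by
  rw [reply, sum_coupling_mul]

lemma reply_mem_Ioc (hs : 0 ≤ s) {σ : Group → ℝ} (hσ : ∀ g, σ g ∈ Set.Icc (0 : ℝ) 1)
    (l : Group) : Q.reply s σ l ∈ Set.Ioc (0 : ℝ) 1 := by
  have h1 := Q.resp_pos l (hσ l)
  have h2 := Q.resp_mem_Icc l (hσ l)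
  have h3 := Q.resp_mem_Icc l.other (hσ l.other)
  have h4 := mul_nonneg hs h3.1
  have h5 := mul_le_mul_of_nonneg_left h3.2 hs
  rw [reply_eq]
  exact ⟨div_pos (by linarith) (by linarith),
    div_le_one_of_le₀ (by linarith [h2.2]) (by linarith)⟩

/-- The energy decreases along `reply`, at least by the square of the change of the responses in
the positive semidefinite form `coupling s / (1 + s)`. -/
lemma energy_reply_le (hs : 0 ≤ s) {σ : Group → ℝ} (hσ : ∀ g, σ g ∈ Set.Icc (0 : ℝ) 1)
    (l : Group) {d : Group → ℝ}
    (hd : ∀ g, d g = Q.resp g (σ g) - Q.resp g (Q.reply s σ g)) :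
    Q.energy s (Q.reply s σ)
      ≤ Q.energy s σ - ((d l + s * d l.other) ^ 2 + (1 - s ^ 2) * d l.other ^ 2) / (2 * (1 + s)) := by
  have hs1 : 1 + s ≠ 0 := by linarith
  have hb : ∀ g, Q.reply s σ g ∈ Set.Icc (0 : ℝ) 1 := fun g =>
    ⟨(reply_mem_Ioc hs hσ g).1.le, (reply_mem_Ioc hs hσ g).2⟩
  have hA := primitive_tangent (Q := Q) Group.A (hσ Group.A) (hb Group.A)
  have hB := primitive_tangent (Q := Q) Group.B (hσ Group.B) (hb Group.B)
  have hform : (d l + s * d l.other) ^ 2 + (1 - s ^ 2) * d l.other ^ 2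
      = d Group.A ^ 2 + 2 * s * (d Group.A * d Group.B) + d Group.B ^ 2 := by
    cases l <;> simp only [Group.other] <;> ring
  rw [hform, hd, hd]
  have hrA := reply_eq (Q := Q) s σ Group.A
  have hrB := reply_eq (Q := Q) s σ Group.B
  simp only [Group.other] at hrA hrB
  simp only [energy, sum_group]
  generalize Q.reply s σ Group.A = bA at *
  generalize Q.reply s σ Group.B = bB at *
  generalize Q.resp Group.A (σ Group.A) = FA at *
  generalize Q.resp Group.B (σ Group.B) = FB at *
  generalize Q.resp Group.A bA = GA at *
  generalize Q.resp Group.B bB = GB at *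
  have key : (bA * GA - FA * bA - GA ^ 2 / 2 + FA ^ 2 / 2)
      + (bB * GB - FB * bB - GB ^ 2 / 2 + FB ^ 2 / 2)
      + s / (2 * (1 + s)) * (GA - GB) ^ 2 - s / (2 * (1 + s)) * (FA - FB) ^ 2
      = -(((FA - GA) ^ 2 + 2 * s * ((FA - GA) * (FB - GB)) + (FB - GB) ^ 2) / (2 * (1 + s))) := by
    rw [hrA, hrB]
    field_simp
    ring
  linarith

lemma drift_min_nonpos (hs : 0 ≤ s) {X Y : Group → ℝ} (hX : ∀ g, X g ∈ Set.Icc (0 : ℝ) 1)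
    (hY : ∀ g, Y g ∈ Set.Icc (0 : ℝ) 1) (hdX : ∀ g, Q.drift s X g ≤ 0)
    (hdY : ∀ g, Q.drift s Y g ≤ 0) (l : Group) : Q.drift s (fun g => min (X g) (Y g)) l ≤ 0 := by
  have hm : ∀ g, min (X g) (Y g) ∈ Set.Icc (0 : ℝ) 1 := fun g =>
    ⟨le_min (hX g).1 (hY g).1, (min_le_left _ _).trans (hX g).2⟩
  rcases le_total (X l) (Y l) with h | h
  · exact (Q.drift_mono hs hm hX (fun g => min_le_left _ _) (min_eq_left h)).trans (hdX l)
  · exact (Q.drift_mono hs hm hY (fun g => min_le_right _ _) (min_eq_right h)).trans (hdY l)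

lemma drift_max_nonneg (hs : 0 ≤ s) {X Y : Group → ℝ} (hX : ∀ g, X g ∈ Set.Icc (0 : ℝ) 1)
    (hY : ∀ g, Y g ∈ Set.Icc (0 : ℝ) 1) (hdX : ∀ g, 0 ≤ Q.drift s X g)
    (hdY : ∀ g, 0 ≤ Q.drift s Y g) (l : Group) : 0 ≤ Q.drift s (fun g => max (X g) (Y g)) l := by
  have hm : ∀ g, max (X g) (Y g) ∈ Set.Icc (0 : ℝ) 1 := fun g =>
    ⟨(hX g).1.trans (le_max_left _ _), max_le (hX g).2 (hY g).2⟩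
  rcases le_total (X l) (Y l) with h | h
  · exact (hdY l).trans (Q.drift_mono hs hY hm (fun g => le_max_right _ _) (max_eq_right h).symm)
  · exact (hdX l).trans (Q.drift_mono hs hX hm (fun g => le_max_left _ _) (max_eq_left h).symm)

/-- The attractor minimizes the energy below `oddsMul R X`: this box is invariant under `reply`,
so the image of a minimizer is again a minimizer and an equilibrium, and the only equilibrium in
the box is the attractor. -/
lemma IsAttractor.energy_le_of_le_oddsMul (hs : 0 ≤ s) (hs1 : s ≤ 1) {X : Group → ℝ}
    (hX : Q.IsAttractor s X) {R : ℝ} (hR : 1 < R) {σ : Group → ℝ} (hσ0 : ∀ g, 0 ≤ σ g)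
    (hσ : ∀ g, σ g ≤ oddsMul R (X g)) : Q.energy s X ≤ Q.energy s σ := by
  have hXI : ∀ g, X g ∈ Set.Icc (0 : ℝ) 1 := fun g => ⟨(hX.mem g).1.le, (hX.mem g).2⟩
  set c : Group → ℝ := fun g => oddsMul R (X g) with hc
  have hcI : ∀ g, c g ∈ Set.Icc (0 : ℝ) 1 := fun g => oddsMul_mem_Icc hR.le (hXI g)
  set box : Set (Group → ℝ) := Set.univ.pi fun g => Set.Icc 0 (c g) with hbox
  have hboxI : ∀ τ ∈ box, ∀ g, τ g ∈ Set.Icc (0 : ℝ) 1 := fun τ hτ g =>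
    ⟨(hτ g (Set.mem_univ g)).1, (hτ g (Set.mem_univ g)).2.trans (hcI g).2⟩
  have hσbox : σ ∈ box := fun g _ => ⟨hσ0 g, hσ g⟩
  obtain ⟨a, ha, hamin⟩ := (isCompact_univ_pi fun g => isCompact_Icc).exists_isMinOn
    ⟨σ, hσbox⟩ ((continuousOn_energy (Q := Q) s).mono hboxI)
  have haI := hboxI a ha
  have hdc : ∀ l, Q.drift s c l ≤ 0 := by
    intro l
    rcases (hX.mem l).2.lt_or_eq with h | h
    · exact (Q.drift_oddsMul_neg hs hR hXI h (hX.drift_eq_zero l).le).le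
    · exact Q.drift_nonpos_of_eq_one hs hcI (by rw [hc]; simp only [h, oddsMul_one_right hR.le])
  set b := Q.reply s a with hb
  have hbm := fun g => reply_mem_Ioc (Q := Q) hs haI g
  have hbI : ∀ g, b g ∈ Set.Icc (0 : ℝ) 1 := fun g => ⟨(hbm g).1.le, (hbm g).2⟩
  have hbc : ∀ l, b l ≤ c l := by
    intro l
    have h1 := hdc l
    rw [drift_eq] at h1
    rw [hb, reply, div_le_iff₀ (by linarith)]
    have h2 : ∑ g, coupling s l g * Q.resp g (a g) ≤ ∑ g, coupling s l g * Q.resp g (c g) :=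
      Finset.sum_le_sum fun g _ => mul_le_mul_of_nonneg_left
        (Q.resp_mono g (haI g) (hcI g) (ha g (Set.mem_univ g)).2) (coupling_nonneg hs l g)
    linarith
  have hbbox : b ∈ box := fun g _ => ⟨(hbI g).1, hbc g⟩
  have hbd : ∀ l, Q.drift s b l = 0 := by
    intro l
    have h1 := energy_reply_le (Q := Q) hs haI l (fun g => rfl)
    have h2 : Q.energy s a ≤ Q.energy s b := hamin hbbox
    rw [← hb] at h1
    set dl := Q.resp l (a l) - Q.resp l (b l) with hdl
    set d' := Q.resp l.other (a l.other) - Q.resp l.other (b l.other) with hd'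
    have h3 : ((dl + s * d') ^ 2 + (1 - s ^ 2) * d' ^ 2) / (2 * (1 + s)) ≤ 0 := by linarith
    have h4 : 0 ≤ (1 - s ^ 2) * d' ^ 2 := by
      have : 0 ≤ 1 - s ^ 2 := by nlinarith
      positivity
    have h5 : (dl + s * d') ^ 2 = 0 := by
      have h6 := (div_le_iff₀ (by linarith : 0 < 2 * (1 + s))).1 h3
      nlinarith [sq_nonneg (dl + s * d')]
    have h6 : dl + s * d' = 0 := pow_eq_zero_iff two_ne_zero |>.1 h5
    have h7 : b l = (Q.resp l (a l) + s * Q.resp l.other (a l.other)) / (1 + s) :=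
      reply_eq s a l
    rw [drift_eq, sum_coupling_mul, h7, mul_div_cancel₀ _ (by linarith : 1 + s ≠ 0), ← h7]
    rw [hdl, hd'] at h6
    linarith
  have hlo := fun l => drift_min_nonpos (Q := Q) hs hXI hbI
    (fun g => (hX.drift_eq_zero g).le) (fun g => (hbd g).le) l
  have hup := fun l => drift_max_nonneg (Q := Q) hs hXI hbI
    (fun g => (hX.drift_eq_zero g).ge) (fun g => (hbd g).ge) l
  have hlom : ∀ g, min (X g) (b g) ∈ Set.Ioc (0 : ℝ) 1 := fun g =>
    ⟨lt_min (hX.mem g).1 (hbm g).1, (min_le_left _ _).trans (hX.mem g).2⟩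
  have heq := Q.eq_of_drift_nonpos_of_drift_nonneg hs hlom
    (up := fun g => max (X g) (b g))
    (fun g => ⟨(hX.mem g).1.trans_le (le_max_left _ _), max_le (hX.mem g).2 (hbm g).2⟩)
    (fun g => min_le_max) (fun g hg => by
      have h1 := hX.lt_one g _ hlom hlo hg
      exact max_lt h1 ((hbc g).trans_lt (oddsMul_lt_one hR.le (hXI g).1 h1))) hlo hup
  have hXb : X = b := by
    funext g
    have := congrFun heq g
    rcases le_total (X g) (b g) with h | h
    · rwa [min_eq_left h, max_eq_right h] at this
    · rw [min_eq_right h, max_eq_left h] at this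
      exact this.symm
  have h1 := energy_reply_le (Q := Q) hs haI Group.A (fun g => rfl)
  have h2 : 0 ≤ (1 - s ^ 2) := by nlinarith
  rw [hXb]
  refine h1.trans ((sub_le_self _ (by positivity)).trans (hamin hσbox))

/-- The attractor minimizes the energy on the whole square. -/
lemma IsAttractor.energy_le (hs : 0 ≤ s) (hs1 : s ≤ 1) {X : Group → ℝ} (hX : Q.IsAttractor s X)
    {σ : Group → ℝ} (hσ : ∀ g, σ g ∈ Set.Icc (0 : ℝ) 1) : Q.energy s X ≤ Q.energy s σ := by
  have hsub : ∀ r ∈ Set.Ico (0 : ℝ) 1, Q.energy s X ≤ Q.energy s fun g => r * σ g := by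
    intro r hr
    have hloc : ∀ g, ∃ R : ℝ, 1 < R ∧ r * σ g ≤ oddsMul R (X g) := by
      intro g
      have hx := hX.mem g
      have hr1 : 0 < 1 - r := by linarith [hr.2]
      have hx0 := hx.1
      have hrσ : r * σ g ≤ r := mul_le_of_le_one_right hr.1 (hσ g).2
      refine ⟨1 + 1 / (X g * (1 - r)), by
        have : 0 < 1 / (X g * (1 - r)) := by positivity
        linarith, hrσ.trans ?_⟩
      set R := 1 + 1 / (X g * (1 - r)) with hR
      have h1 : R * (X g * (1 - r)) = X g * (1 - r) + 1 := by
        rw [hR, add_mul, one_mul, div_mul_cancel₀ _ (by positivity)]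
      have hR1 : 1 ≤ R := by
        have : 0 < 1 / (X g * (1 - r)) := by positivity
        linarith
      have h2 := oddsMul_den_pos hR1 hx0.le
      rw [oddsMul, le_div_iff₀ (by linarith)]
      nlinarith [hr.1, hr.2, hx.2]
    choose R hR hRσ using hloc
    refine hX.energy_le_of_le_oddsMul hs hs1 (R := max (R Group.A) (R Group.B))
      ((hR _).trans_le (le_max_left _ _)) (fun g => mul_nonneg hr.1 (hσ g).1)
      fun g => (hRσ g).trans (oddsMul_mono (hR g).le ?_ ⟨(hX.mem g).1.le, (hX.mem g).2⟩)
    cases g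
    · exact le_max_left _ _
    · exact le_max_right _ _
  have hlim : Tendsto (fun n : ℕ => (fun g => (1 - 1 / ((n : ℝ) + 1)) * σ g : Group → ℝ)) atTop
      (𝓝[{σ | ∀ g, σ g ∈ Set.Icc (0 : ℝ) 1}] σ) := by
    refine tendsto_nhdsWithin_iff.2 ⟨tendsto_pi_nhds.2 fun g => ?_, Eventually.of_forall
      fun n g => ?_⟩
    · have := (tendsto_one_div_add_atTop_nhds_zero_nat (𝕜 := ℝ)).const_sub 1
      simpa using this.mul_const (σ g)
    · have h1 : 0 < 1 / ((n : ℝ) + 1) := Nat.one_div_pos_of_nat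
      have h2 : 1 / ((n : ℝ) + 1) ≤ 1 := by
        rw [div_le_one (by positivity)]; linarith [n.cast_nonneg (α := ℝ)]
      exact ⟨mul_nonneg (by linarith) (hσ g).1,
        mul_le_one₀ (by linarith) (hσ g).1 (hσ g).2⟩
  refine ge_of_tendsto (((continuousOn_energy (Q := Q) s) σ hσ).tendsto.comp hlim)
    (Eventually.of_forall fun n => hsub _ ⟨?_, ?_⟩)
  · have h2 : 1 / ((n : ℝ) + 1) ≤ 1 := by
      rw [div_le_one (by positivity)]; linarith [n.cast_nonneg (α := ℝ)]
    linarith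
  · have h1 : 0 < 1 / ((n : ℝ) + 1) := Nat.one_div_pos_of_nat
    linarith

/-- A larger `s` puts a larger weight on the squared difference of the responses, so the minimizer
of the energy makes this difference smaller. -/
theorem abs_resp_sub_le_of_isAttractor {s' : ℝ} (hs : 0 ≤ s) (hss : s < s') (hs1 : s' ≤ 1)
    {X X' : Group → ℝ} (hX : Q.IsAttractor s X) (hX' : Q.IsAttractor s' X') :
    |Q.resp Group.A (X' Group.A) - Q.resp Group.B (X' Group.B)|
      ≤ |Q.resp Group.A (X Group.A) - Q.resp Group.B (X Group.B)| := by
  have hXI : ∀ g, X g ∈ Set.Icc (0 : ℝ) 1 := fun g => ⟨(hX.mem g).1.le, (hX.mem g).2⟩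
  have hXI' : ∀ g, X' g ∈ Set.Icc (0 : ℝ) 1 := fun g => ⟨(hX'.mem g).1.le, (hX'.mem g).2⟩
  have h1 := hX.energy_le hs (hss.le.trans hs1) hXI'
  have h2 := hX'.energy_le (hs.trans hss.le) hs1 hXI
  simp only [energy] at h1 h2
  rw [← sq_le_sq]
  have h3 : s / (2 * (1 + s)) < s' / (2 * (1 + s')) := by
    rw [div_lt_div_iff₀ (by linarith) (by linarith)]
    nlinarith
  nlinarith

end ClickModel

/-! ### From the search model to the chain -/

instance : DiscreteMeasurableSpace Group := ⟨fun _ => trivial⟩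

namespace ClickModel

variable (Q : ClickModel) {s : ℝ} {κ : ℕ → ℝ} {σ₀ : Group → ℝ}

/-- The chain along a path of draws. -/
noncomputable def path (s : ℝ) (κ : ℕ → ℝ) (σ₀ : Group → ℝ) (d : ℕ → Draw) : ℕ → Group → ℝ
  | 0 => σ₀
  | t + 1 => Q.update s (κ t) (d t) (path s κ σ₀ d t)

variable {Q}

lemma path_congr {d d' : ℕ → Draw} {t : ℕ} (h : ∀ i < t, d i = d' i) :
    Q.path s κ σ₀ d t = Q.path s κ σ₀ d' t := by
  induction t with
  | zero => rfl
  | succ t ih =>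
    rw [path, path, h t t.lt_succ_self, ih fun i hi => h i (hi.trans t.lt_succ_self)]

/-- The state at time `t` is a function of the finitely many draws before `t`. -/
lemma exists_eq_comp_restrict (t : ℕ) (φ : (Group → ℝ) → ℝ) :
    ∃ H : (Finset.range t → Draw) → ℝ, ∀ d : ℕ → Draw,
      φ (Q.path s κ σ₀ d t) = H fun i => d i := by
  refine ⟨fun x => φ (Q.path s κ σ₀ (fun i => if h : i ∈ Finset.range t then x ⟨i, h⟩
    else (Group.A, true, true)) t), fun d => ?_⟩
  congr 1
  refine path_congr fun i hi => ?_
  rw [dif_pos (Finset.mem_range.2 hi)]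

variable {P : Measure Draw} [IsProbabilityMeasure P]

lemma integrable_path (t : ℕ) (φ : (Group → ℝ) → ℝ) :
    Integrable (fun d : ℕ → Draw => φ (Q.path s κ σ₀ d t)) (Measure.infinitePi fun _ : ℕ => P) := by
  obtain ⟨H, hH⟩ := exists_eq_comp_restrict (Q := Q) (s := s) (κ := κ) (σ₀ := σ₀) t φ
  simp only [hH]
  have hm : Measurable fun (d : ℕ → Draw) (i : Finset.range t) => d i := by fun_prop
  have := Measure.isProbabilityMeasure_map (μ := Measure.infinitePi fun _ : ℕ => P)
    hm.aemeasurable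
  exact (Integrable.of_finite (f := H)).comp_measurable hm

/-- The draw of period `t` is independent of the state at time `t`. -/
lemma integral_indicator_mul_path (t : ℕ) (c : Draw) (φ : (Group → ℝ) → ℝ) :
    ∫ d, Set.indicator {c} 1 (d t) * φ (Q.path s κ σ₀ d t) ∂(Measure.infinitePi fun _ : ℕ => P)
      = P.real {c} * ∫ d, φ (Q.path s κ σ₀ d t) ∂(Measure.infinitePi fun _ : ℕ => P) := by
  obtain ⟨H, hH⟩ := exists_eq_comp_restrict (Q := Q) (s := s) (κ := κ) (σ₀ := σ₀) t φ
  simp only [hH]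
  have hind : iIndepFun (fun (i : ℕ) (d : ℕ → Draw) => d i) (Measure.infinitePi fun _ : ℕ => P) :=
    iIndepFun_infinitePi (X := fun _ (x : Draw) => x) fun _ => measurable_id
  have h1 := hind.indepFun_finset {t} (Finset.range t) (by simp) fun i => measurable_pi_apply i
  have h2 := h1.comp (φ := fun x => Set.indicator {c} (1 : Draw → ℝ) (x ⟨t, by simp⟩))
    (ψ := H) Measurable.of_discrete Measurable.of_discrete
  have hm : Measurable fun d : ℕ → Draw => Set.indicator {c} (1 : Draw → ℝ) (d t) :=
    (Measurable.of_discrete (f := Set.indicator {c} (1 : Draw → ℝ))).comp (measurable_pi_apply t)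
  have hm' : Measurable fun d : ℕ → Draw => H fun i => d i :=
    (Measurable.of_discrete (f := H)).comp (by fun_prop)
  have h3 := h2.integral_fun_mul_eq_mul_integral hm.aestronglyMeasurable
    hm'.aestronglyMeasurable
  refine h3.trans ?_
  congr 1
  have hpres := measurePreserving_eval_infinitePi (fun _ : ℕ => P) t
  have h4 : ∫ d, Set.indicator {c} (1 : Draw → ℝ) (d t) ∂(Measure.infinitePi fun _ : ℕ => P)
      = ∫ x, Set.indicator {c} (1 : Draw → ℝ) x ∂P := by
    conv_rhs => rw [← hpres.map_eq]
    rw [integral_map hpres.measurable.aemeasurable Measurable.of_discrete.aestronglyMeasurable]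
  refine h4.trans ?_
  rw [integral_indicator_one (measurableSet_singleton c)]

lemma integral_draw_path (t : ℕ) (φ : Draw → (Group → ℝ) → ℝ) :
    ∫ d, φ (d t) (Q.path s κ σ₀ d t) ∂(Measure.infinitePi fun _ : ℕ => P)
      = ∑ c, P.real {c} * ∫ d, φ c (Q.path s κ σ₀ d t) ∂(Measure.infinitePi fun _ : ℕ => P) := by
  have h1 : ∀ d : ℕ → Draw, φ (d t) (Q.path s κ σ₀ d t)
      = ∑ c, Set.indicator {c} 1 (d t) * φ c (Q.path s κ σ₀ d t) := by
    intro d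
    rw [Finset.sum_eq_single (d t) (fun c _ hc => by simp [hc.symm]) (by simp)]
    simp
  simp only [h1]
  rw [integral_finsetSum]
  · exact Finset.sum_congr rfl fun c _ => integral_indicator_mul_path t c (φ c)
  · intro c _
    refine (integrable_path (Q := Q) t (φ c)).bdd_mul (c := 1) ?_ (Eventually.of_forall fun d => ?_)
    · exact ((Measurable.of_discrete (f := Set.indicator {c} (1 : Draw → ℝ))).comp
        (measurable_pi_apply t)).aestronglyMeasurable
    · by_cases h : d t = c <;> simp [h]

lemma integral_path (hP : ∀ c, P.real {c} = Q.weight c) (t : ℕ) (φ : (Group → ℝ) → ℝ) :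
    ∫ d, φ (Q.path s κ σ₀ d t) ∂(Measure.infinitePi fun _ : ℕ => P) = Q.ev s κ σ₀ t φ := by
  induction t generalizing φ with
  | zero => simp [path, ev]
  | succ t ih =>
    have h1 := integral_draw_path (Q := Q) (P := P) (s := s) (κ := κ) (σ₀ := σ₀) t
      fun c σ => φ (Q.update s (κ t) c σ)
    simp only [path]
    rw [h1, ev, ← ih]
    simp only [trans]
    rw [integral_finsetSum]
    · exact Finset.sum_congr rfl fun c _ => by rw [hP, integral_const_mul]
    · exact fun c _ => (integrable_path (Q := Q) t
        fun σ => φ (Q.update s (κ t) c σ)).const_mul _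

end ClickModel

/-! ### Aggregation of the rankings -/

/-- Value, before division by the number of websites with signal `b`, of a website with signal `b`
for an individual with signals `x` and `z`. -/
noncomputable def signalValue (γ : ℝ) (x z b : Bool) : ℝ :=
  if x = b ∧ z = b then 1 else if x = b then γ else if z = b then 1 - γ else 0

lemma signalValue_nonneg {γ : ℝ} (h0 : 0 ≤ γ) (h1 : γ ≤ 1) (x z b : Bool) :
    0 ≤ signalValue γ x z b := by
  unfold signalValue
  split_ifs <;> linarith

lemma signalValue_add_pos (γ : ℝ) (x z b : Bool) :
    0 < signalValue γ x z b + signalValue γ x z (!b) := by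
  cases x <;> cases z <;> cases b <;> simp [signalValue]

/-- Number of websites with signal `b`. -/
def siteCount {M : ℕ} (y : Fin M → Bool) (b : Bool) : ℝ :=
  ((Finset.univ.filter fun m => y m = b).card : ℝ)

lemma rankingFreeValue_eq {M : ℕ} {y : Fin M → Bool} (hy : ¬ ∀ m₁ m₂, y m₁ = y m₂) (γ : ℝ)
    (x z : Bool) (m : Fin M) :
    rankingFreeValue γ y x z m = signalValue γ x z (y m) / siteCount y (y m) := by
  rw [rankingFreeValue, if_neg hy]
  rfl

lemma exists_site {M : ℕ} {y : Fin M → Bool} (hy : ¬ ∀ m₁ m₂, y m₁ = y m₂) (b : Bool) :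
    ∃ m, y m = b := by
  push Not at hy
  obtain ⟨m₁, m₂, h⟩ := hy
  by_cases h1 : y m₁ = b
  · exact ⟨m₁, h1⟩
  · refine ⟨m₂, ?_⟩
    revert h h1
    cases y m₁ <;> cases y m₂ <;> cases b <;> simp

lemma siteCount_pos {M : ℕ} {y : Fin M → Bool} (hy : ¬ ∀ m₁ m₂, y m₁ = y m₂) (b : Bool) :
    0 < siteCount y b := by
  obtain ⟨m, hm⟩ := exists_site hy b
  exact Nat.cast_pos.2 (Finset.card_pos.2 ⟨m, by simp [hm]⟩)

/-- Probability that a signal of accuracy `a` is correct (`true`) or not (`false`). -/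
def accuracyProb (a : ℝ) (b : Bool) : ℝ := if b then a else 1 - a

namespace Environment

variable (E : Environment) (ω : Bool) {y : Fin E.M → Bool}

/-- The aggregate model of a search environment whose websites do not all carry the same signal.
The signals that agree with the majority leave no value to the other websites. -/
noncomputable def clickModel (hy : ¬ ∀ m₁ m₂, y m₁ = y m₂) : ClickModel where
  prob c := accuracyProb E.p c.1 * accuracyProb E.μ c.2
  prob_nonneg c := by
    have h1 := E.half_lt_p
    have h2 := E.p_lt_one
    have h3 := E.half_lt_μ
    have h4 := E.μ_le_one
    unfold accuracyProb
    split_ifs <;> exact mul_nonneg (by linarith) (by linarith)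
  prob_sum := by
    simp only [Fintype.sum_prod_type, Fintype.sum_bool, accuracyProb, if_true,
      Bool.false_eq_true, if_false]
    ring
  wK g c := signalValue (E.γ g) (signal ω c.1) (signal (majoritySignal y) c.2) (majoritySignal y)
    / siteCount y (majoritySignal y)
  wL g c := signalValue (E.γ g) (signal ω c.1) (signal (majoritySignal y) c.2) (!majoritySignal y)
    / siteCount y (!majoritySignal y)
  wK_nonneg g c := div_nonneg (signalValue_nonneg (E.γ_nonneg g) (E.γ_le_one g) _ _ _)
    (siteCount_pos hy _).le
  wL_nonneg g c := div_nonneg (signalValue_nonneg (E.γ_nonneg g) (E.γ_le_one g) _ _ _)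
    (siteCount_pos hy _).le
  w_pos g c := by
    have h1 := siteCount_pos hy (majoritySignal y)
    have h2 := siteCount_pos hy (!majoritySignal y)
    have h3 := signalValue_nonneg (E.γ_nonneg g) (E.γ_le_one g) (signal ω c.1)
      (signal (majoritySignal y) c.2) (majoritySignal y)
    have h4 := signalValue_nonneg (E.γ_nonneg g) (E.γ_le_one g) (signal ω c.1)
      (signal (majoritySignal y) c.2) (!majoritySignal y)
    have h5 := signalValue_add_pos (E.γ g) (signal ω c.1) (signal (majoritySignal y) c.2)
      (majoritySignal y)
    rcases h3.eq_or_lt with h | h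
    · rw [← h, zero_add] at h5
      rw [← h, zero_div, zero_add]
      exact div_pos h5 h2
    · exact add_pos_of_pos_of_nonneg (div_pos h h1) (div_nonneg h4 h2.le)
  sure := (decide (ω = majoritySignal y), true)
  sure_pos := by
    have h1 := E.half_lt_p
    have h2 := E.p_lt_one
    have h3 := E.half_lt_μ
    unfold accuracyProb
    split_ifs <;> first | exact mul_pos (by linarith) (by linarith) | simp_all
  wL_sure g := by
    cases ω <;> cases majoritySignal y <;> simp [signalValue, signal]

variable {E ω}

/-- Total click probability of the majority websites, and of all websites. -/
lemma sum_choice (hy : ¬ ∀ m₁ m₂, y m₁ = y m₂) (g : Group) (c : Bool × Bool) {r : Fin E.M → ℝ}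
    (hr : ∀ m, 0 < r m) (hr1 : ∑ m, r m = 1) :
    ∑ m ∈ majoritySites y, E.choice ω y g c r m
        = (E.clickModel ω hy).click g c (∑ m ∈ majoritySites y, r m) ∧
      ∑ m, E.choice ω y g c r m = 1 ∧ ∀ m, 0 ≤ E.choice ω y g c r m := by
  set Q := E.clickModel ω hy with hQ
  set a := ∑ m ∈ majoritySites y, r m with ha
  have hK : ∀ m ∈ majoritySites y, rankingFreeValue (E.γ g) y (signal ω c.1)
      (signal (majoritySignal y) c.2) m = Q.wK g c := by
    intro m hm
    have h1 : y m = majoritySignal y := by simpa [majoritySites] using hm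
    rw [rankingFreeValue_eq hy, h1]
    rfl
  have hL : ∀ m ∈ (majoritySites y)ᶜ, rankingFreeValue (E.γ g) y (signal ω c.1)
      (signal (majoritySignal y) c.2) m = Q.wL g c := by
    intro m hm
    have h1 : y m = !majoritySignal y := by
      have : ¬ y m = majoritySignal y := by simpa [majoritySites] using hm
      revert this
      cases y m <;> cases majoritySignal y <;> simp
    rw [rankingFreeValue_eq hy, h1]
    rfl
  have hcompl : ∑ m ∈ (majoritySites y)ᶜ, r m = 1 - a := by
    rw [← hr1, ← Finset.sum_add_sum_compl (majoritySites y) r]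
    ring
  have hapos : 0 < a := by
    obtain ⟨m, hm⟩ := exists_site hy (majoritySignal y)
    exact Finset.sum_pos (fun m _ => hr m) ⟨m, by simp [majoritySites, hm]⟩
  have hbpos : 0 < 1 - a := by
    rw [← hcompl]
    obtain ⟨m, hm⟩ := exists_site hy (!majoritySignal y)
    exact Finset.sum_pos (fun m _ => hr m) ⟨m, by simp [majoritySites, hm]⟩
  have hsK : ∑ m ∈ majoritySites y, r m * rankingFreeValue (E.γ g) y (signal ω c.1)
      (signal (majoritySignal y) c.2) m = Q.wK g c * a := by
    rw [Finset.sum_congr rfl fun m hm => by rw [hK m hm], ← Finset.sum_mul, mul_comm]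
  have hsL : ∑ m ∈ (majoritySites y)ᶜ, r m * rankingFreeValue (E.γ g) y (signal ω c.1)
      (signal (majoritySignal y) c.2) m = Q.wL g c * (1 - a) := by
    rw [Finset.sum_congr rfl fun m hm => by rw [hL m hm], ← Finset.sum_mul, mul_comm, hcompl]
  have hs : ∑ m, r m * rankingFreeValue (E.γ g) y (signal ω c.1)
      (signal (majoritySignal y) c.2) m = Q.wK g c * a + Q.wL g c * (1 - a) := by
    rw [← Finset.sum_add_sum_compl (majoritySites y), hsK, hsL]
  have hk0 := Q.wK_nonneg g c
  have hl0 := Q.wL_nonneg g c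
  have hpos : 0 < Q.wK g c * a + Q.wL g c * (1 - a) := by
    have h1 := mul_nonneg hk0 hapos.le
    have h2 := mul_nonneg hl0 hbpos.le
    rcases hk0.eq_or_lt with h | h
    · have h3 := Q.w_pos g c
      rw [← h, zero_add] at h3
      have := mul_pos h3 hbpos
      linarith
    · have := mul_pos h hapos
      linarith
  refine ⟨?_, ?_, fun m => ?_⟩
  · simp only [choice, clickProb]
    rw [← Finset.sum_div, hsK, hs, ClickModel.click, share]
    split_ifs with h
    · rw [h, zero_mul, add_zero] at hpos ⊢
      exact div_self hpos.ne'
    · rfl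
  · simp only [choice, clickProb]
    rw [← Finset.sum_div, hs]
    exact div_self hpos.ne'
  · rw [choice, clickProb, hs]
    refine div_nonneg (mul_nonneg (hr m).le ?_) hpos.le
    by_cases hm : m ∈ majoritySites y
    · rw [hK m hm]; exact hk0
    · rw [hL m (Finset.mem_compl.2 hm)]; exact hl0

lemma one_sub_discount (lam : ℝ) (l g : Group) : 1 - discount lam l g = coupling (1 - lam) l g := by
  unfold discount coupling
  split_ifs <;> ring

lemma ranking_pos_sum (hy : ¬ ∀ m₁ m₂, y m₁ = y m₂) {lam : ℝ} (hlam : lam ≤ 1) (d : ℕ → Draw)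
    (t : ℕ) : ∀ l, (∀ m, 0 < E.ranking ω y lam d t l m) ∧ ∑ m, E.ranking ω y lam d t l m = 1 := by
  induction t with
  | zero => exact fun l => ⟨E.r₁_pos, E.r₁_sum⟩
  | succ t ih =>
    intro l
    have hκ : (0 : ℝ) < E.κ t := Nat.cast_pos.2 (E.κ_pos t)
    have hc := coupling_nonneg (sub_nonneg.2 hlam) l (d t).1
    obtain ⟨-, h1, h2⟩ := sum_choice (ω := ω) hy (d t).1 (d t).2 (ih (d t).1).1 (ih (d t).1).2
    simp only [ranking, one_sub_discount]
    refine ⟨fun m => ?_, ?_⟩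
    · have h3 := (ih l).1 m
      have h4 := h2 m
      positivity
    · rw [Finset.sum_add_distrib, ← Finset.mul_sum, ← Finset.mul_sum, (ih l).2, h1]
      field_simp
      ring

/-- The ranking masses of the majority websites follow the chain. -/
lemma sum_ranking_eq_path (hy : ¬ ∀ m₁ m₂, y m₁ = y m₂) {lam : ℝ} (hlam : lam ≤ 1)
    (d : ℕ → Draw) (t : ℕ) (l : Group) :
    ∑ m ∈ majoritySites y, E.ranking ω y lam d t l m
      = (E.clickModel ω hy).path (1 - lam) (fun t => E.κ t)
        (fun _ => ∑ m ∈ majoritySites y, E.r₁ m) d t l := by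
  induction t generalizing l with
  | zero => rfl
  | succ t ih =>
    have h := ranking_pos_sum (ω := ω) hy hlam d t (d t).1
    simp only [ranking, one_sub_discount]
    rw [Finset.sum_add_distrib, ← Finset.mul_sum, ← Finset.mul_sum, ih,
      (sum_choice hy (d t).1 (d t).2 h.1 h.2).1, ih]
    rfl

lemma drawLaw_real_singleton (hsize : E.shareA = 1 / 2) (hy : ¬ ∀ m₁ m₂, y m₁ = y m₂) (c : Draw) :
    E.drawLaw.real {c} = (E.clickModel ω hy).weight c := by
  obtain ⟨g, b₁, b₂⟩ := c
  have h1 : ({(g, b₁, b₂)} : Set Draw) = {g} ×ˢ ({b₁} ×ˢ {b₂}) := by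
    rw [Set.singleton_prod_singleton, Set.singleton_prod_singleton]
  have hb : ∀ (p : unitInterval) (b : Bool),
      (bernoulliMeasure true false p).real {b} = accuracyProb p b := by
    intro p b
    classical
    rw [bernoulliMeasure_real_apply p (measurableSet_singleton b)]
    cases b <;> simp [accuracyProb]
  have hg : (bernoulliMeasure Group.A Group.B
      ⟨E.shareA, E.shareA_pos.le, E.shareA_lt_one.le⟩).real {g} = 1 / 2 := by
    classical
    rw [bernoulliMeasure_real_apply _ (measurableSet_singleton g)]
    cases g <;> simp [hsize]
    norm_num
  rw [h1, drawLaw, measureReal_prod_prod, measureReal_prod_prod, hg, hb, hb]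
  rfl

lemma expectedClick_eq_ev (hsize : E.shareA = 1 / 2) (hy : ¬ ∀ m₁ m₂, y m₁ = y m₂) {lam : ℝ}
    (hlam : lam ≤ 1) (l : Group) (t : ℕ) :
    E.expectedClick ω y lam l t (majoritySites y)
      = (E.clickModel ω hy).ev (1 - lam) (fun t => E.κ t)
        (fun _ => ∑ m ∈ majoritySites y, E.r₁ m) t
        fun σ => (E.clickModel ω hy).resp l (σ l) := by
  set Q := E.clickModel ω hy with hQ
  set σ₀ : Group → ℝ := fun _ => ∑ m ∈ majoritySites y, E.r₁ m with hσ₀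
  have hP : ∀ c, E.drawLaw.real {c} = Q.weight c := drawLaw_real_singleton hsize hy
  have h1 : ∀ d : ℕ → Draw, ∑ m ∈ majoritySites y,
      E.choice ω y l (d t).2 (E.ranking ω y lam d t l) m
      = Q.click l (d t).2 (Q.path (1 - lam) (fun t => E.κ t) σ₀ d t l) := by
    intro d
    have h := ranking_pos_sum (ω := ω) hy hlam d t l
    rw [(sum_choice hy l (d t).2 h.1 h.2).1, sum_ranking_eq_path hy hlam]
  rw [expectedClick, pathLaw]
  simp only [h1]
  rw [ClickModel.integral_draw_path t fun c σ => Q.click l c.2 (σ l)]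
  have h2 : ∀ c : Draw, ∫ d, Q.click l c.2 (Q.path (1 - lam) (fun t => E.κ t) σ₀ d t l)
      ∂(Measure.infinitePi fun _ : ℕ => E.drawLaw)
      = Q.ev (1 - lam) (fun t => E.κ t) σ₀ t fun σ => Q.click l c.2 (σ l) := fun c =>
    ClickModel.integral_path hP t fun σ => Q.click l c.2 (σ l)
  simp only [h2, hP]
  have h3 : ∀ (ι : Finset (Bool × Bool)), ∑ c ∈ ι, Q.prob c *
      Q.ev (1 - lam) (fun t => E.κ t) σ₀ t (fun σ => Q.click l c (σ l))
      = Q.ev (1 - lam) (fun t => E.κ t) σ₀ t fun σ => ∑ c ∈ ι, Q.prob c * Q.click l c (σ l) := by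
    intro ι
    induction ι using Finset.induction_on with
    | empty => simp [ClickModel.ev_const]
    | insert c ι hc ih =>
      rw [Finset.sum_insert hc, ih, ← ClickModel.ev_const_mul, ← ClickModel.ev_add]
      congr 1
      funext σ
      rw [Finset.sum_insert hc]
  rw [ClickModel.sum_weight_mul]
  simp only [h3, sum_group]
  simp only [ClickModel.resp]
  ring

/-- If all websites carry the same signal, every individual clicks on a majority website. -/
lemma beliefPolarization_eq_zero (hy : ∀ m₁ m₂, y m₁ = y m₂) {lam : ℝ} (hlam : lam ≤ 1) (t : ℕ) :
    E.beliefPolarization ω y lam t = 0 := by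
  have hM : 0 < E.M := E.odd_M.pos
  have hall : ∀ m, y m = majoritySignal y := by
    intro m
    have h1 : ∀ m', y m' = y m := fun m' => hy m' m
    unfold majoritySignal
    simp only [h1]
    cases y m <;> simp [hM]
  have hsites : majoritySites y = Finset.univ := by
    ext m
    simp [majoritySites, hall m]
  have hchoice : ∀ g c r, ∑ m, r m = 1 → ∑ m, E.choice ω y g c r m = 1 := by
    intro g c r hr
    simp only [choice, clickProb, rankingFreeValue, if_pos hy, mul_one, hr, div_one]
  have hsum : ∀ (d : ℕ → Draw) t l, ∑ m, E.ranking ω y lam d t l m = 1 := by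
    intro d t
    induction t with
    | zero => exact fun _ => E.r₁_sum
    | succ t ih =>
      intro l
      have hκ : (0 : ℝ) < E.κ t := Nat.cast_pos.2 (E.κ_pos t)
      have hc := coupling_nonneg (sub_nonneg.2 hlam) l (d t).1
      simp only [ranking, one_sub_discount]
      rw [Finset.sum_add_distrib, ← Finset.mul_sum, ← Finset.mul_sum, ih, hchoice _ _ _ (ih _)]
      field_simp
      ring
  have h1 : ∀ l, E.expectedClick ω y lam l t (majoritySites y) = 1 := by
    intro l
    simp only [expectedClick, hsites, hchoice _ _ _ (hsum _ t l)]
    simp [pathLaw]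
  rw [beliefPolarization, h1, h1, sub_self, abs_zero]

/-- The belief polarization converges to the difference of the responses at the attractor. -/
lemma exists_isAttractor_tendsto_beliefPolarization (hsize : E.shareA = 1 / 2)
    (hκ : Tendsto E.κ atTop atTop)
    (hκO : (fun t : ℕ => (E.κ t : ℝ)) =O[atTop] (fun t : ℕ => (t : ℝ)))
    (hy : ¬ ∀ m₁ m₂, y m₁ = y m₂) {lam : ℝ} (hlam : lam ∈ Set.Icc (0 : ℝ) 1) :
    ∃ X : Group → ℝ, (E.clickModel ω hy).IsAttractor (1 - lam) X ∧
      Tendsto (fun N : ℕ => E.beliefPolarization ω y lam N) atTop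
        (𝓝 |(E.clickModel ω hy).resp Group.A (X Group.A)
          - (E.clickModel ω hy).resp Group.B (X Group.B)|) := by
  set Q := E.clickModel ω hy with hQ
  have hκpos : ∀ t, (0 : ℝ) < E.κ t := fun t => Nat.cast_pos.2 (E.κ_pos t)
  have hκ0 : Tendsto (fun t => 1 / (E.κ t : ℝ)) atTop (𝓝 0) := by
    simp only [one_div]
    exact tendsto_inv_atTop_zero.comp (tendsto_natCast_atTop_atTop.comp hκ)
  have hκs : ¬ Summable fun t => 1 / (E.κ t : ℝ) := by
    intro h
    obtain ⟨C, hC0, hC⟩ := hκO.exists_pos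
    have h1 : ∀ᶠ t : ℕ in atTop, ‖(1 : ℝ) / t‖ ≤ C * (1 / (E.κ t : ℝ)) := by
      filter_upwards [hC.bound, eventually_gt_atTop 0] with t ht ht0
      have ht0' : (0 : ℝ) < t := Nat.cast_pos.2 ht0
      rw [Real.norm_of_nonneg (hκpos t).le, Real.norm_of_nonneg ht0'.le] at ht
      rw [Real.norm_of_nonneg (by positivity), mul_one_div, div_le_div_iff₀ ht0' (hκpos t)]
      linarith
    exact Real.not_summable_one_div_natCast
      (Summable.of_norm_bounded_eventually_nat (h.mul_left C) h1)
  have hσ₀ : ClickModel.IsInterior fun _ => ∑ m ∈ majoritySites y, E.r₁ m := by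
    intro _
    obtain ⟨m, hm⟩ := exists_site hy (majoritySignal y)
    obtain ⟨m', hm'⟩ := exists_site hy (!majoritySignal y)
    refine ⟨Finset.sum_pos (fun m _ => E.r₁_pos m) ⟨m, by simp [majoritySites, hm]⟩, ?_⟩
    have h1 : 0 < ∑ m ∈ (majoritySites y)ᶜ, E.r₁ m :=
      Finset.sum_pos (fun m _ => E.r₁_pos m) ⟨m', by simp [majoritySites, hm']⟩
    have h2 := Finset.sum_add_sum_compl (majoritySites y) E.r₁
    rw [E.r₁_sum] at h2
    show ∑ m ∈ majoritySites y, E.r₁ m < 1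
    linarith
  have hs : 0 ≤ 1 - lam := by linarith [hlam.2]
  obtain ⟨X, hX, hlim⟩ := ClickModel.exists_isAttractor_tendsto (Q := Q) hs
    (by linarith [hlam.1]) hκpos hκ0 hκs hσ₀
  refine ⟨X, hX, ?_⟩
  have hresp := fun l => ClickModel.tendsto_ev_resp hs hκpos hσ₀
    ⟨(hX.mem l).1.le, (hX.mem l).2⟩ (hlim l)
  simp only [beliefPolarization, expectedClick_eq_ev hsize hy hlam.2]
  exact ((hresp Group.A).sub (hresp Group.B)).abs

end Environment

end SearchModel

theorem proposition4 (E : SearchModel.Environment)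
    (hsize : E.shareA = 1 / 2)
    (hκ : Tendsto E.κ atTop atTop)
    (hκO : (fun t : ℕ => (E.κ t : ℝ)) =O[atTop] (fun t : ℕ => (t : ℝ)))
    (ω : Bool) (y : Fin E.M → Bool) :
    ∃ BP : ℝ → ℝ,
      (∀ lam ∈ Set.Icc (0 : ℝ) 1,
        Tendsto (fun N : ℕ => E.beliefPolarization ω y lam N) atTop (𝓝 (BP lam))) ∧
      MonotoneOn BP (Set.Icc 0 1) := by
  by_cases hy : ∀ m₁ m₂, y m₁ = y m₂
  · refine ⟨fun _ => 0, fun lam hlam => ?_, fun _ _ _ _ _ => le_rfl⟩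
    simp only [SearchModel.Environment.beliefPolarization_eq_zero hy hlam.2]
    exact tendsto_const_nhds
  · choose! X hX hlim using fun (lam : ℝ) (hlam : lam ∈ Set.Icc (0 : ℝ) 1) =>
      SearchModel.Environment.exists_isAttractor_tendsto_beliefPolarization (ω := ω)
        hsize hκ hκO hy hlam
    refine ⟨_, hlim, fun a ha b hb hab => ?_⟩
    rcases hab.eq_or_lt with rfl | hlt
    · exact le_rfl
    · exact SearchModel.ClickModel.abs_resp_sub_le_of_isAttractor (by linarith [hb.2])
        (by linarith) (by linarith [ha.1]) (hX b hb) (hX a ha)
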